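/- **Model.** A data stream of length $m$ over the alphabet $[n]=\{1,\dots,n\}$ is a sequence $\sigma=(a_1,\dots,a_m)\in[n]^m$, and $F_0(\sigma)=|\{j\in[n] : a_i=j \text{ for some } i\in[m]\}|$ is its number of distinct elements. A *verifier* is one fixed program, independent of all parameters, over finitely many registers that hold natural numbers (assignments with $+,-,\times$, integer division and remainder, tests $<$ and $=$, branching and loops). It has read-only access to $m$, $n$ and to two tuning parameters $s,w$; sequential one-pass access to the input stream $\sigma$ and to a proof stream $\omega\in\{0,1\}^*$ (detecting the end of each); oracle access to a common random string $r$ of finite length; and finitely many private fair coin tosses. Its space is the largest total bit length of its registers during the run. It outputs a natural number or the rejection symbol $\bot$; write $A^r(\sigma,\omega)$ for the output, a random variable over the private coins. For $\delta>0$ and natural numbers $S,W$, the verifier is an $\mathrm{AM}_{0,\delta}(S,W)$ streaming algorithm for $F_0$ on $[n]^m$ if every run, for every $\sigma$, $r$, $\omega$ and every outcome of the private coins, halts and uses at most $S$ bits of space, and if for every $\sigma\in[n]^m$, with probability at least $1-\delta/2$ over a uniformly random $r$, there is a non-empty set $\mathcal W_\sigma(r)$ of proof streams of length at most $W$ such that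 * (completeness) $\Pr[A^r(\sigma,\omega)=F_0(\sigma)]>1-\delta/2$ for every $\omega\in\mathcal W_\sigma(r)$; * (soundness) $\Pr[A^r(\sigma,\omega)=\bot]>1-\delta/2$ for every $\omega\notin\mathcal W_\sigma(r)$, both probabilities being over the private coins. **Theorem.** There are a single verifier $A$ and constants $C,c\in\mathbb N$ such that for all natural numbers $m,n\ge 0$ and all positive integers $s,w$ with $s\cdot w\ge n$, the verifier $A$, run with tuning parameters $s,w$, is an $$\mathrm{AM}_{0,1/3}\bigl(s\cdot T(m,n),\; w\cdot T(m,n)\bigr),\qquad T(m,n)=C\,\bigl(\lfloor\log_2(m+n)\rfloor+1\bigr)^{c},$$ streaming algorithm for the Distinct Elements problem, i.e. for computing $F_0(\sigma)$ exactly on streams of length $m$ over $[n]$ (with the convention $\lfloor\log_2 0\rfloor=0$). -/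

import Mathlib

namespace AMStreaming

/-! ### The machine model

A streaming verifier is a fixed finite program over finitely many registers, each of which holds a
natural number. The space in use at a given moment is the total number of bits of the register
contents. The program has
* read-only access to the numbers `m`, `n` (length and alphabet size of the stream) and to the two
  tuning parameters `s`, `w`;
* sequential one-pass access to the input stream and to the proof stream, in any interleaving;
* oracle access to the common random string;
* private coin tosses.
One program serves all values of `m`, `n`, `s`, `w`. -/

/-- What a program can consult without changing it: the parameters and the common random string
(an oracle from positions to bits). -/
structure Env where
  m : ℕ
  n : ℕ
  s : ℕ
  w : ℕ
  r : ℕ → Bool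

/-- Operands: a register, a numeral of the program text, or one of the read-only parameters. -/
inductive Operand (V : Type) where
  | reg (v : V)
  | const (c : ℕ)
  | m
  | n
  | s
  | w

/-- Arithmetic on natural numbers: `sub` is truncated, `div` rounds down. -/
inductive ArithOp where
  | add
  | sub
  | mul
  | div
  | mod

def ArithOp.eval : ArithOp → ℕ → ℕ → ℕ
  | add, a, b => a + b
  | sub, a, b => a - b
  | mul, a, b => a * b
  | div, a, b => a / b
  | mod, a, b => a % b

inductive Test (V : Type) where
  | lt (a b : Operand V)
  | eq (a b : Operand V)

/-- Instructions that write one register. -/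
inductive Instr (V : Type) where
  /-- `v := a op b` -/
  | arith (v : V) (op : ArithOp) (a b : Operand V)
  /-- `v :=` next element of the input stream (a number in `1, …, n`), or `0` at its end -/
  | readInput (v : V)
  /-- `v := 1 +` next bit of the proof stream, or `0` at its end -/
  | readProof (v : V)
  /-- `v :=` the bit of the common random string at position `a` -/
  | query (v : V) (a : Operand V)
  /-- `v :=` a fresh private coin toss -/
  | toss (v : V)

inductive Cmd (V : Type) where
  | skip
  | instr (i : Instr V)
  | seq (c₁ c₂ : Cmd V)
  | ite (t : Test V) (c₁ c₂ : Cmd V)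
  | loop (t : Test V) (c : Cmd V)

/-- The register contents and the parts of the two streams and of the private coin sequence that
have not been read yet. -/
structure State (V : Type) where
  regs : V → ℕ
  input : List ℕ
  proof : List Bool
  coins : List Bool

/-- The number of bits held in the registers. -/
def State.space {V : Type} [Fintype V] (st : State V) : ℕ := ∑ v, (st.regs v).size

def Operand.eval {V : Type} (e : Env) (st : State V) : Operand V → ℕ
  | reg v => st.regs v
  | const c => c
  | m => e.m
  | n => e.n
  | s => e.s
  | w => e.w

def Test.Holds {V : Type} (e : Env) (st : State V) : Test V → Prop
  | lt a b => a.eval e st < b.eval e st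
  | eq a b => a.eval e st = b.eval e st

def State.set {V : Type} [DecidableEq V] (st : State V) (v : V) (x : ℕ) : State V :=
  { st with regs := Function.update st.regs v x }

/-- The effect of an instruction; it is undefined only for a coin toss when no coin is left. -/
def Instr.step {V : Type} [DecidableEq V] (e : Env) (st : State V) : Instr V → Option (State V)
  | arith v op a b => some (st.set v (op.eval (a.eval e st) (b.eval e st)))
  | readInput v =>
      match st.input with
      | [] => some (st.set v 0)
      | a :: l => some ({ st with input := l }.set v a)
  | readProof v =>
      match st.proof with
      | [] => some (st.set v 0)
      | b :: l => some ({ st with proof := l }.set v (b.toNat + 1))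
  | query v a => some (st.set v (e.r (a.eval e st)).toNat)
  | toss v =>
      match st.coins with
      | [] => none
      | b :: l => some ({ st with coins := l }.set v b.toNat)

/-- `Exec e S c st st'`: started in `st`, the command `c` halts in `st'`, and no instruction
executed on the way leaves more than `S` bits in the registers. -/
inductive Exec {V : Type} [Fintype V] [DecidableEq V] (e : Env) (S : ℕ) :
    Cmd V → State V → State V → Prop
  | skip (st : State V) : Exec e S Cmd.skip st st
  | instr (i : Instr V) (st st' : State V) (h : i.step e st = some st') (hS : st'.space ≤ S) :
      Exec e S (Cmd.instr i) st st'
  | seq (c₁ c₂ : Cmd V) (st st' st'' : State V)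
      (h₁ : Exec e S c₁ st st') (h₂ : Exec e S c₂ st' st'') : Exec e S (Cmd.seq c₁ c₂) st st''
  | iteTrue (t : Test V) (c₁ c₂ : Cmd V) (st st' : State V) (ht : t.Holds e st)
      (h : Exec e S c₁ st st') : Exec e S (Cmd.ite t c₁ c₂) st st'
  | iteFalse (t : Test V) (c₁ c₂ : Cmd V) (st st' : State V) (ht : ¬ t.Holds e st)
      (h : Exec e S c₂ st st') : Exec e S (Cmd.ite t c₁ c₂) st st'
  | loopDone (t : Test V) (c : Cmd V) (st : State V) (ht : ¬ t.Holds e st) :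
      Exec e S (Cmd.loop t c) st st
  | loopStep (t : Test V) (c : Cmd V) (st st' st'' : State V) (ht : t.Holds e st)
      (h₁ : Exec e S c st st') (h₂ : Exec e S (Cmd.loop t c) st' st'') :
      Exec e S (Cmd.loop t c) st st''

/-- Execution is deterministic once the streams, the random string and the coins are fixed. -/
theorem Exec.unique {V : Type} [Fintype V] [DecidableEq V] {e : Env} {S T : ℕ} {c : Cmd V}
    {st st₁ st₂ : State V} (h₁ : Exec e S c st st₁) (h₂ : Exec e T c st st₂) : st₁ = st₂ := by
  induction h₁ generalizing st₂ with
  | skip st => cases h₂; rfl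
  | instr i st st' h hS =>
    cases h₂ with
    | instr _ _ _ h' _ => exact Option.some.inj (h.symm.trans h')
  | seq c₁ c₂ st st' st'' _ _ ih₁ ih₂ =>
    cases h₂ with
    | seq _ _ _ _ _ k₁ k₂ =>
      obtain rfl := ih₁ k₁
      exact ih₂ k₂
  | iteTrue t c₁ c₂ st st' ht _ ih =>
    cases h₂ with
    | iteTrue _ _ _ _ _ _ k => exact ih k
    | iteFalse _ _ _ _ _ ht' _ => exact absurd ht ht'
  | iteFalse t c₁ c₂ st st' ht _ ih =>
    cases h₂ with
    | iteTrue _ _ _ _ _ ht' _ => exact absurd ht' ht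
    | iteFalse _ _ _ _ _ _ k => exact ih k
  | loopDone t c st ht =>
    cases h₂ with
    | loopDone => rfl
    | loopStep _ _ _ _ _ ht' _ _ => exact absurd ht' ht
  | loopStep t c st st' st'' ht _ _ ih₁ ih₂ =>
    cases h₂ with
    | loopDone _ _ _ ht' => exact absurd ht ht'
    | loopStep _ _ _ _ _ _ k₁ k₂ =>
      obtain rfl := ih₁ k₁
      exact ih₂ k₂

/-- A verifier: a program over a finite set `V` of registers, and the register that holds its
answer when it halts. -/
structure Verifier where
  V : Type
  [fintypeV : Fintype V]
  [decEqV : DecidableEq V]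
  code : Cmd V
  out : V

attribute [instance] Verifier.fintypeV Verifier.decEqV

/-- The output convention: `0` stands for `⊥`, and `x + 1` for the value `x`. -/
def decodeOutput : ℕ → Option ℕ
  | 0 => none
  | x + 1 => some x

/-- The common random string of length `R` as an oracle; positions beyond its end read as `0`. -/
def oracleOf {R : ℕ} (r : Fin R → Bool) (i : ℕ) : Bool := if h : i < R then r ⟨i, h⟩ else false

/-- With tuning parameters `s`, `w`, on the input stream `σ`, common random string `r`, proof stream
`ω` and private coins `ρ`, the verifier halts within `S` bits of space and outputs `o`, where
`none` stands for `⊥`. All registers are `0` at the start. -/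
def Verifier.Outputs (A : Verifier) (s w S : ℕ) {m n R K : ℕ} (σ : Fin m → Fin n)
    (r : Fin R → Bool) (ω : List Bool) (ρ : Fin K → Bool) (o : Option ℕ) : Prop :=
  ∃ st' : State A.V,
    Exec ⟨m, n, s, w, oracleOf r⟩ S A.code
      ⟨fun _ => 0, List.ofFn fun i => (σ i : ℕ) + 1, ω, List.ofFn ρ⟩ st' ∧
    decodeOutput (st'.regs A.out) = o

/-! ### Arthur–Merlin streaming algorithms -/

/-- A data stream problem: a real-valued function for each stream length `m` and alphabet size
`n`. -/
abbrev DataStreamProblem := ∀ m n : ℕ, (Fin m → Fin n) → ℝ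

open Classical in
/-- The probability of the event `p` under the uniform distribution on `k`-bit strings. -/
noncomputable def prob {k : ℕ} (p : (Fin k → Bool) → Prop) : ℝ :=
  ((Finset.univ.filter p).card : ℝ) / 2 ^ k

/-- `A`, run with tuning parameters `s`, `w`, is an `AM_{ε,δ}(S, W)` streaming algorithm for the
problem `P` on streams of length `m` over an alphabet of size `n`. Here `R` is the length of the
common random string and `K` bounds the number of private coin tosses. The first clause says that
every run, whatever the proof, halts and uses at most `S` bits. The relative error condition
`|x / P σ - 1| ≤ ε` is written without division. -/
def Verifier.IsAM (A : Verifier) (P : DataStreamProblem) (ε δ : ℝ) (m n s w S W : ℕ) : Prop :=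
  ∃ R K : ℕ,
    (∀ (σ : Fin m → Fin n) (r : Fin R → Bool) (ω : List Bool) (ρ : Fin K → Bool),
      ∃ o, A.Outputs s w S σ r ω ρ o) ∧
    ∀ σ : Fin m → Fin n,
      1 - δ / 2 ≤ prob fun r : Fin R → Bool =>
        ∃ 𝒲 : Set (List Bool), 𝒲.Nonempty ∧ (∀ ω ∈ 𝒲, ω.length ≤ W) ∧
          (∀ ω ∈ 𝒲, 1 - δ / 2 < prob fun ρ : Fin K → Bool =>
            ∃ x : ℕ, A.Outputs s w S σ r ω ρ (some x) ∧ |(x : ℝ) - P m n σ| ≤ ε * |P m n σ|) ∧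
          (∀ ω ∉ 𝒲, 1 - δ / 2 < prob fun ρ : Fin K → Bool => A.Outputs s w S σ r ω ρ none)

/-- The Distinct Elements problem: the number `F₀(σ)` of distinct elements of the stream. -/
noncomputable def distinctElements : DataStreamProblem :=
  fun _ _ σ => ((Finset.univ.image σ).card : ℝ)

end AMStreaming

namespace AMStreaming

open Polynomial

/-! Place the alphabet in a grid of at most `2 * s` rows and at most `w` columns, so that `F₀` is
the number of occupied cells. Testing directly whether the number of occurrences in a cell is
nonzero takes a polynomial whose degree grows with `m`, which makes the proof too long. Random
subsampling lowers the degree. The common random string selects sets of stream positions, at every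
rate `2 ^ -(u + 1)` and in logarithmically many independent trials. If some selection contains
exactly one occurrence of an element, then the product of `1 - count` over all selections vanishes;
for an absent element every count is `0` and the product is `1`. Hence `1 - ∏ (1 - count)` is the
indicator of occupancy as soon as every present element is isolated (`Isolates`).

Extend each count to a polynomial in the column by Lagrange interpolation modulo a prime
(`slotPoly`). Summing `1 - ∏ (1 - slotPoly)` over the rows gives `rowPoly`, of degree at most
`factors * width`, whose values at the columns add up to `F₀` (`sum_eval_rowPoly`). The prover sends
its values at `nodes` points. The verifier draws a point from its private coins, computes the value
of `rowPoly` there from one running sum per slot, and compares it with the value interpolated from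
the proof. A wrong polynomial passes with probability below `1/6` (`prob_agree_le`,
`six_mul_nodes_lt`); the right one always passes.

Isolation is a second-moment estimate: at a rate adapted to the number of occurrences, one trial
fails with probability at most `7/8` (`card_chosen_ne_one`). Independence of the trials and a union
bound over positions give `prob_isolates`.

The remainder implements this on the register machine (`verifier_runs`). All slots are packed as
digits of one number, so one bound `M` on the registers controls the space (`size_register_le`).
Running time is free, which permits trial division and naive exponentiation. -/

/-- The registers of the verifier. -/
inductive Reg where
  | q | lam | wd | ht | U | G | K | D | B | xi
  | p | bs | i | x | y | nn | lag | t | e | tmp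
  | k | z | b | acc | pos | V | pr | ev | tot | val | out
  deriving DecidableEq

instance : Fintype Reg where
  elems := {.q, .lam, .wd, .ht, .U, .G, .K, .D, .B, .xi,
    .p, .bs, .i, .x, .y, .nn, .lag, .t, .e, .tmp,
    .k, .z, .b, .acc, .pos, .V, .pr, .ev, .tot, .val, .out}
  complete v := by cases v <;> simp

/-! ### Configurations as records, and a program logic that bounds every register. -/

/-- The contents of all registers, and what is left of the streams and the coins. -/
@[ext]
structure Conf where
  -- The default `0` is the initial content of a register, so only nonzero registers need to be
  -- written. Programs below reset their scratch registers to keep this form.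
  (q lam wd ht U G K D B xi p bs i x y nn lag t e tmp k z b acc pos V pr ev tot val out : ℕ := 0)
  input : List ℕ
  proof : List Bool
  coins : List Bool

namespace Conf

def get (c : Conf) : Reg → ℕ
  | .q => c.q
  | .lam => c.lam
  | .wd => c.wd
  | .ht => c.ht
  | .U => c.U
  | .G => c.G
  | .K => c.K
  | .D => c.D
  | .B => c.B
  | .xi => c.xi
  | .p => c.p
  | .bs => c.bs
  | .i => c.i
  | .x => c.x
  | .y => c.y
  | .nn => c.nn
  | .lag => c.lag
  | .t => c.t
  | .e => c.e
  | .tmp => c.tmp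
  | .k => c.k
  | .z => c.z
  | .b => c.b
  | .acc => c.acc
  | .pos => c.pos
  | .V => c.V
  | .pr => c.pr
  | .ev => c.ev
  | .tot => c.tot
  | .val => c.val
  | .out => c.out

def put (c : Conf) (a : ℕ) : Reg → Conf
  | .q => { c with q := a }
  | .lam => { c with lam := a }
  | .wd => { c with wd := a }
  | .ht => { c with ht := a }
  | .U => { c with U := a }
  | .G => { c with G := a }
  | .K => { c with K := a }
  | .D => { c with D := a }
  | .B => { c with B := a }
  | .xi => { c with xi := a }
  | .p => { c with p := a }
  | .bs => { c with bs := a }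
  | .i => { c with i := a }
  | .x => { c with x := a }
  | .y => { c with y := a }
  | .nn => { c with nn := a }
  | .lag => { c with lag := a }
  | .t => { c with t := a }
  | .e => { c with e := a }
  | .tmp => { c with tmp := a }
  | .k => { c with k := a }
  | .z => { c with z := a }
  | .b => { c with b := a }
  | .acc => { c with acc := a }
  | .pos => { c with pos := a }
  | .V => { c with V := a }
  | .pr => { c with pr := a }
  | .ev => { c with ev := a }
  | .tot => { c with tot := a }
  | .val => { c with val := a }
  | .out => { c with out := a }

theorem get_put (c : Conf) (a : ℕ) (u v : Reg) :
    (c.put a v).get u = if u = v then a else c.get u := by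
  cases v <;> cases u <;> rfl

theorem put_input (c : Conf) (a : ℕ) (v : Reg) : (c.put a v).input = c.input := by
  cases v <;> rfl

theorem put_proof (c : Conf) (a : ℕ) (v : Reg) : (c.put a v).proof = c.proof := by
  cases v <;> rfl

theorem put_coins (c : Conf) (a : ℕ) (v : Reg) : (c.put a v).coins = c.coins := by
  cases v <;> rfl

def toState (c : Conf) : State Reg := ⟨c.get, c.input, c.proof, c.coins⟩

theorem toState_put (c : Conf) (a : ℕ) (v : Reg) : (c.put a v).toState = c.toState.set v a := by
  unfold toState State.set
  congr 1
  · funext u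
    rw [get_put, Function.update_apply]
  · exact put_input c a v
  · exact put_proof c a v
  · exact put_coins c a v

end Conf

/-- From the configuration `c`, in which no register exceeds `M`, the command `p` leads to `c'` and
keeps every register at most `M` all the way. -/
def Runs (e : Env) (M : ℕ) (p : Cmd Reg) (c c' : Conf) : Prop :=
  (∀ v, c.get v ≤ M) →
    Exec e (Fintype.card Reg * M.size) p c.toState c'.toState ∧ ∀ v, c'.get v ≤ M

def block : List (Cmd Reg) → Cmd Reg
  | [] => .skip
  | p :: l => .seq p (block l)

/-- `v := a op b` -/
def assign (v : Reg) (op : ArithOp) (a b : Operand Reg) : Cmd Reg := .instr (.arith v op a b)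

/-- `for v < b do p`, with `v` reset to `0` in the end -/
def forLoop (v : Reg) (b : Operand Reg) (p : Cmd Reg) : Cmd Reg :=
  block [assign v .add (.const 0) (.const 0),
    .loop (.lt (.reg v) b) (block [p, assign v .add (.reg v) (.const 1)]),
    assign v .add (.const 0) (.const 0)]

section Logic

variable {e : Env} {M : ℕ}

/-- One bound for all registers costs only the constant factor `Fintype.card Reg`, so no register
needs its own accounting. -/
theorem space_le {c : Conf} (h : ∀ v, c.get v ≤ M) :
    c.toState.space ≤ Fintype.card Reg * M.size := by
  have : c.toState.space ≤ ∑ _v : Reg, M.size :=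
    Finset.sum_le_sum fun v _ => Nat.size_le_size (h v)
  simpa using this

theorem Runs.nil {c c' : Conf} (h : c = c') : Runs e M (block []) c c' :=
  fun hc => h ▸ ⟨.skip _, hc⟩

theorem Runs.cons {p : Cmd Reg} {l : List (Cmd Reg)} {c c' c'' : Conf} (h : Runs e M p c c')
    (h' : Runs e M (block l) c' c'') : Runs e M (block (p :: l)) c c'' := fun hc =>
  have h₁ := h hc
  have h₂ := h' h₁.2
  ⟨.seq _ _ _ _ _ h₁.1 h₂.1, h₂.2⟩

theorem Runs.step {i : Instr Reg} {c c₀ : Conf} {v : Reg} {a : ℕ}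
    (hi : i.step e c.toState = some (c₀.put a v).toState) (h₀ : c₀.get = c.get) (ha : a ≤ M) :
    Runs e M (.instr i) c (c₀.put a v) := fun hc => by
  have : ∀ u, (c₀.put a v).get u ≤ M := fun u => by
    rw [Conf.get_put]
    split
    · exact ha
    · rw [h₀]
      exact hc u
  exact ⟨.instr _ _ _ hi (space_le this), this⟩

/-- Continuation form: the new value `x` is given in the wanted normal form, and the rest of the
block is verified from the updated record. -/
theorem Runs.arith {l : List (Cmd Reg)} {v : Reg} {op : ArithOp} {a b : Operand Reg}
    {c c' : Conf} (x : ℕ) (hx : op.eval (a.eval e c.toState) (b.eval e c.toState) = x) (hM : x ≤ M)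
    (h : Runs e M (block l) (c.put x v) c') : Runs e M (block (assign v op a b :: l)) c c' := by
  refine .cons (.step ?_ rfl hM) h
  simp only [Instr.step, Conf.toState_put, hx]

theorem Runs.readInput {l : List (Cmd Reg)} {v : Reg} {c c' : Conf} {x : ℕ} {t : List ℕ}
    (hx : c.input = x :: t) (hM : x ≤ M)
    (h : Runs e M (block l) (({ c with input := t } : Conf).put x v) c') :
    Runs e M (block (.instr (.readInput v) :: l)) c c' := by
  refine .cons (.step (c₀ := { c with input := t }) ?_ rfl hM) h
  have : c.toState.input = x :: t := hx
  simp only [Instr.step, Conf.toState_put, this]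
  rfl

theorem Runs.toss {l : List (Cmd Reg)} {v : Reg} {c c' : Conf} {x : Bool} {t : List Bool}
    (hx : c.coins = x :: t) (hM : x.toNat ≤ M)
    (h : Runs e M (block l) (({ c with coins := t } : Conf).put x.toNat v) c') :
    Runs e M (block (.instr (.toss v) :: l)) c c' := by
  refine .cons (.step (c₀ := { c with coins := t }) ?_ rfl hM) h
  have : c.toState.coins = x :: t := hx
  simp only [Instr.step, Conf.toState_put, this]
  rfl

theorem Runs.query {l : List (Cmd Reg)} {v : Reg} {a : Operand Reg} {c c' : Conf} (x : ℕ)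
    (hx : (e.r (a.eval e c.toState)).toNat = x) (hM : x ≤ M)
    (h : Runs e M (block l) (c.put x v) c') :
    Runs e M (block (.instr (.query v a) :: l)) c c' := by
  refine .cons (.step ?_ rfl hM) h
  simp only [Instr.step, Conf.toState_put, hx]

/-- The number that reading the proof stream yields. -/
def proofSymbol : List Bool → ℕ
  | [] => 0
  | b :: _ => b.toNat + 1

theorem Runs.readProof {l : List (Cmd Reg)} {v : Reg} {c c' : Conf}
    (hM : proofSymbol c.proof ≤ M)
    (h : Runs e M (block l)
      (({ c with proof := c.proof.tail } : Conf).put (proofSymbol c.proof) v) c') :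
    Runs e M (block (.instr (.readProof v) :: l)) c c' := by
  refine .cons (.step (c₀ := { c with proof := c.proof.tail }) ?_ rfl hM) h
  obtain ⟨q, hq⟩ : ∃ q, c.proof = q := ⟨_, rfl⟩
  have : c.toState.proof = q := hq
  simp only [Instr.step, Conf.toState_put, this, hq]
  cases q
  · have h₀ : ({ c with proof := [] } : Conf) = c := by rw [← hq]
    rw [List.tail_nil, h₀]
    rfl
  · rfl

theorem Runs.iteTrue {t : Test Reg} {p p' : Cmd Reg} {c c' : Conf} (ht : t.Holds e c.toState)
    (h : Runs e M p c c') : Runs e M (.ite t p p') c c' :=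
  fun hc => ⟨.iteTrue _ _ _ _ _ ht (h hc).1, (h hc).2⟩

theorem Runs.iteFalse {t : Test Reg} {p p' : Cmd Reg} {c c' : Conf} (ht : ¬ t.Holds e c.toState)
    (h : Runs e M p' c c') : Runs e M (.ite t p p') c c' :=
  fun hc => ⟨.iteFalse _ _ _ _ _ ht (h hc).1, (h hc).2⟩

theorem Runs.loop {t : Test Reg} {p : Cmd Reg} (F : ℕ → Conf) (N : ℕ)
    (ht : ∀ k < N, t.Holds e (F k).toState) (hN : ¬ t.Holds e (F N).toState)
    (h : ∀ k < N, Runs e M p (F k) (F (k + 1))) : Runs e M (.loop t p) (F 0) (F N) := by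
  -- Induction on the number `k` of iterations that remain.
  suffices ∀ k ≤ N, Runs e M (.loop t p) (F (N - k)) (F N) by simpa using this N le_rfl
  intro k hk
  induction k with
  | zero => exact fun hc => ⟨.loopDone _ _ _ hN, hc⟩
  | succ k ih =>
    intro hc
    have h₁ := h (N - (k + 1)) (by omega) hc
    have h₂ := ih (by omega)
    rw [show N - k = N - (k + 1) + 1 by omega] at h₂
    have h₃ := h₂ h₁.2
    exact ⟨.loopStep _ _ _ _ _ (ht _ (by omega)) h₁.1 h₃.1, h₃.2⟩

/-- For loops whose successive configurations have no convenient closed form, such as the search for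
a prime. -/
theorem Runs.loop_of_measure {t : Test Reg} {p : Cmd Reg} (I : Conf → Prop) (μ : Conf → ℕ)
    (h : ∀ c, I c → t.Holds e c.toState → ∃ c', Runs e M p c c' ∧ I c' ∧ μ c' < μ c)
    (c : Conf) (hc : I c) :
    ∃ c', Runs e M (.loop t p) c c' ∧ I c' ∧ ¬ t.Holds e c'.toState := by
  induction hn : μ c using Nat.strong_induction_on generalizing c with
  | _ n ih =>
    by_cases ht : t.Holds e c.toState
    · obtain ⟨c₁, h₁, hI₁, hμ⟩ := h c hc ht
      obtain ⟨c₂, h₂, hI₂, ht₂⟩ := ih _ (hn ▸ hμ) c₁ hI₁ rfl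
      refine ⟨c₂, fun hb => ?_, hI₂, ht₂⟩
      have k₁ := h₁ hb
      have k₂ := h₂ k₁.2
      exact ⟨.loopStep _ _ _ _ _ ht k₁.1 k₂.1, k₂.2⟩
    · exact ⟨c, fun hb => ⟨.loopDone _ _ _ ht, hb⟩, hc, ht⟩

/-- The bound `b` is evaluated anew at each test, hence `hb` for every `k ≤ N`; the body must leave
the counter at `k`. -/
theorem Runs.forLoop {v : Reg} {b : Operand Reg} {p : Cmd Reg} {c c' : Conf} (F : ℕ → Conf)
    (N : ℕ) (hF : ∀ k ≤ N, (F k).get v = k) (hb : ∀ k ≤ N, b.eval e (F k).toState = N)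
    (hNM : N ≤ M) (hc : c.put 0 v = F 0) (hc' : (F N).put 0 v = c')
    (h : ∀ k < N, ∃ c₁, Runs e M p (F k) c₁ ∧ c₁.get v = k ∧ c₁.put (k + 1) v = F (k + 1)) :
    Runs e M (forLoop v b p) c c' := by
  refine .arith 0 rfl (Nat.zero_le _) (.cons (c' := F N) ?_ (.arith 0 rfl (Nat.zero_le _)
    (.nil hc')))
  rw [hc]
  refine .loop F N (fun k hk => ?_) ?_ fun k hk => ?_
  · change (F k).get v < b.eval e _
    rwa [hF k hk.le, hb k hk.le]
  · change ¬ (F N).get v < b.eval e _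
    rw [hF N le_rfl, hb N le_rfl]
    exact lt_irrefl _
  · obtain ⟨c₁, h₁, hv, hput⟩ := h k hk
    refine .cons h₁ (.arith (k + 1) ?_ (hNM.trans' hk) (.nil hput))
    change c₁.get v + 1 = k + 1
    rw [hv]

end Logic

/-! ### Values of Lagrange basis polynomials modulo a prime. -/

/-- `lag :=` the value at `xi` of the Lagrange basis polynomial of `x` for the nodes `0, …, nn - 1`,
modulo `p`; inverses are computed as `(p - 2)`-th powers. -/
def lagrangeCode : Cmd Reg :=
  block [assign .lag .add (.const 1) (.const 0),
    forLoop .t (.reg .nn) (.ite (.eq (.reg .t) (.reg .x)) (block []) (block [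
      -- Adding `p` first keeps the truncated subtraction exact.
      assign .tmp .add (.reg .xi) (.reg .p),
      assign .tmp .sub (.reg .tmp) (.reg .t),
      assign .lag .mul (.reg .lag) (.reg .tmp),
      assign .lag .mod (.reg .lag) (.reg .p),
      assign .tmp .add (.reg .x) (.reg .p),
      assign .tmp .sub (.reg .tmp) (.reg .t),
      assign .q .sub (.reg .p) (.const 2),
      -- The power is applied by `p - 2` successive multiplications into `lag`; only space matters.
      forLoop .e (.reg .q) (block [
        assign .lag .mul (.reg .lag) (.reg .tmp),
        assign .lag .mod (.reg .lag) (.reg .p)]),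
      assign .tmp .add (.const 0) (.const 0),
      assign .q .add (.const 0) (.const 0)]))]

section

variable {e : Env} {M p : ℕ} [Fact p.Prime]

theorem val_mul_mod (A : ZMod p) (k : ℕ) : A.val * k % p = (A * k).val := by
  rw [← ZMod.val_natCast]
  push_cast
  rw [ZMod.natCast_zmod_val]

theorem val_add_mod (A : ZMod p) (k : ℕ) : (A.val + k) % p = (A + k).val := by
  rw [← ZMod.val_natCast]
  push_cast
  rw [ZMod.natCast_zmod_val]

theorem cast_add_sub {a k : ℕ} (hk : k ≤ p) : ((a + p - k : ℕ) : ZMod p) = a - k := by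
  rw [Nat.cast_sub (by omega)]
  simp

theorem val_mul_sub_mod (A : ZMod p) (a : ℕ) {k : ℕ} (hk : k ≤ p) :
    A.val * (a + p - k) % p = (A * (a - k)).val := by
  rw [val_mul_mod, cast_add_sub hk]

theorem pow_sub_two (a : ZMod p) (h : a ≠ 0) : a ^ (p - 2) = a⁻¹ := by
  have hp := (Fact.out : p.Prime).two_le
  refine eq_inv_of_mul_eq_one_left ?_
  rw [← pow_succ, show p - 2 + 1 = p - 1 by omega, ZMod.pow_card_sub_one_eq_one h]

/-- The Lagrange basis polynomial of `x` for the nodes `0, …, N - 1` modulo `p`. -/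
noncomputable def lagr (p N x : ℕ) [Fact p.Prime] : (ZMod p)[X] :=
  Lagrange.basis (Finset.range N) (fun i : ℕ => (i : ZMod p)) x

theorem eval_basisDivisor (a b x : ZMod p) :
    (Lagrange.basisDivisor a b).eval x = (x - b) * (a - b)⁻¹ := by
  simp [Lagrange.basisDivisor, mul_comm]

/-- The largest intermediate value is a residue times an unreduced difference such as `xi + p - t`,
which is at most `2 * p`; this is the origin of `2 * p * p`. -/
theorem lagrange_runs (hM : 2 * p * p ≤ M) (c : Conf) (hp : c.p = p) (hxi : c.xi ≤ p)
    (hx : c.x < p) (hn : c.nn ≤ p) (ht : c.t = 0) (he : c.e = 0) (htmp : c.tmp = 0)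
    (hq : c.q = 0) :
    Runs e M lagrangeCode c
      { c with lag := ((lagr p c.nn c.x).eval (c.xi : ZMod p)).val } := by
  subst hp
  have hp2 := (Fact.out : c.p.Prime).two_le
  have hpM : 2 * c.p ≤ M := by nlinarith
  have hmul : ∀ (A : ZMod c.p) {k : ℕ}, k ≤ 2 * c.p → A.val * k ≤ M := fun A k hk =>
    (Nat.mul_le_mul (ZMod.val_lt A).le hk).trans (by linarith)
  have hval : ∀ A : ZMod c.p, A.val ≤ M := fun A => by linarith [ZMod.val_lt A]
  -- The running product before step `t`. Erasing `c.x` makes the skipped step `t = c.x` leave it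
  -- unchanged (`hP2`).
  obtain ⟨P, P_eq⟩ : ∃ P : ℕ → ZMod c.p, P = fun t => ∏ u ∈ (Finset.range t).erase c.x,
    (((c.xi : ZMod c.p) - u) * ((c.x : ZMod c.p) - u)⁻¹) := ⟨_, rfl⟩
  have hP : (lagr c.p c.nn c.x).eval (c.xi : ZMod c.p) = P c.nn := by
    simp only [lagr, Lagrange.basis, eval_prod, eval_basisDivisor, P_eq]
  have hP1 : ∀ t, t ≠ c.x →
      P (t + 1) = P t * ((c.xi : ZMod c.p) - t) * ((c.x : ZMod c.p) - t)⁻¹ := fun t ht => by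
    simp only [P_eq]
    rw [Finset.range_add_one, Finset.erase_insert_of_ne ht, Finset.prod_insert (by simp)]
    ring
  have hP2 : P (c.x + 1) = P c.x := by
    simp only [P_eq]
    rw [Finset.range_add_one, Finset.erase_insert (by simp), Finset.erase_eq_of_notMem (by simp)]
  rw [hP]
  refine .arith 1 rfl (by omega) (.cons ?_ (.nil rfl))
  refine .forLoop (fun t => { c with lag := (P t).val, t := t }) c.nn (fun _ _ => rfl)
    (fun _ _ => rfl) (by omega) ?_ ?_
    fun t htn => ⟨{ c with lag := (P (t + 1)).val, t := t }, ?_, rfl, rfl⟩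
  · have : (P 0).val = 1 := by simp [P_eq, ZMod.val_one'' (show c.p ≠ 1 by omega)]
    simp only [this]
    rfl
  · ext1 <;> first | rfl | exact ht.symm
  · by_cases htx : t = c.x
    · refine .iteTrue htx (.nil ?_)
      rw [htx, hP2]
    · refine .iteFalse htx ?_
      refine .arith (c.xi + c.p) rfl (by omega) ?_
      refine .arith (c.xi + c.p - t) rfl (by omega) ?_
      refine .arith ((P t).val * (c.xi + c.p - t)) rfl (hmul _ (by omega)) ?_
      refine .arith (P t * ((c.xi : ZMod c.p) - t)).val
        (val_mul_sub_mod _ _ (by omega)) (hval _) ?_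
      dsimp only [Conf.put]
      refine .arith (c.x + c.p) rfl (by omega) ?_
      refine .arith (c.x + c.p - t) rfl (by omega) ?_
      refine .arith (c.p - 2) rfl (by omega) ?_
      dsimp only [Conf.put]
      refine .cons (.forLoop (fun k => { c with
        lag := (P t * ((c.xi : ZMod c.p) - t) * ((c.x : ZMod c.p) - t) ^ k).val
        t := t, tmp := c.x + c.p - t, q := c.p - 2, e := k }) (c.p - 2) (fun _ _ => rfl)
        (fun _ _ => rfl) (by omega) ?_ rfl fun k hk => ?_) ?_
      · simp only [pow_zero, mul_one]
        rfl
      · refine ⟨_, .arith _ rfl (hmul _ (by omega : c.x + c.p - t ≤ 2 * c.p)) (.arith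
          (P t * ((c.xi : ZMod c.p) - t) * ((c.x : ZMod c.p) - t) ^ (k + 1)).val ?_ (hval _)
          (.nil rfl)), rfl, rfl⟩
        rw [pow_succ, ← mul_assoc, ← val_mul_sub_mod _ _ (by omega : t ≤ c.p)]
        rfl
      · refine .arith 0 rfl (by omega) (.arith 0 rfl (by omega) (.nil ?_))
        have hne : (c.x : ZMod c.p) - t ≠ 0 := by
          rw [sub_ne_zero]
          intro h
          apply htx
          rw [← ZMod.val_natCast_of_lt hx, h, ZMod.val_natCast_of_lt (by omega)]
        rw [hP1 t htx, ← pow_sub_two _ hne]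
        ext1 <;> first | rfl | (symm; assumption)

end

/-! ### Finding the prime modulus by trial division. -/

/-- The least prime that is at least `N`. -/
noncomputable def nextPrime (N : ℕ) : ℕ := sInf {p | N ≤ p ∧ p.Prime}

theorem nextPrime_spec (N : ℕ) : N ≤ nextPrime N ∧ (nextPrime N).Prime :=
  Nat.sInf_mem (s := {p | N ≤ p ∧ p.Prime}) (Nat.exists_infinite_primes N)

theorem nextPrime_le {N p : ℕ} (h : N ≤ p) (hp : p.Prime) : nextPrime N ≤ p :=
  Nat.sInf_le (s := {p | N ≤ p ∧ p.Prime}) ⟨h, hp⟩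

/-- Bertrand's postulate; it is why residues modulo the prime above `2 ^ B` fit into `B + 1` bits.
-/
theorem nextPrime_le_two_mul {N : ℕ} (h : N ≠ 0) : nextPrime N ≤ 2 * N :=
  have ⟨_, hp, h₁, h₂⟩ := Nat.exists_prime_lt_and_le_two_mul N h
  (nextPrime_le h₁.le hp).trans h₂

/-- `p :=` the least prime that is at least `p`, found by trial division -/
def nextPrimeCode : Cmd Reg :=
  block [assign .t .add (.const 2) (.const 0),
    .loop (.lt (.reg .t) (.reg .p)) (block [
      assign .tmp .mod (.reg .p) (.reg .t),
      .ite (.eq (.reg .tmp) (.const 0))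
        (block [assign .p .add (.reg .p) (.const 1), assign .t .add (.const 2) (.const 0)])
        (block [assign .t .add (.reg .t) (.const 1)])]),
    assign .t .add (.const 0) (.const 0),
    assign .tmp .add (.const 0) (.const 0)]

section

variable {e : Env} {M : ℕ}

theorem nextPrime_runs (c : Conf) (hp : 2 ≤ c.p) (ht : c.t = 0) (htmp : c.tmp = 0)
    (hM : nextPrime c.p ≤ M) :
    Runs e M nextPrimeCode c { c with p := nextPrime c.p } := by
  obtain ⟨hle, hpr⟩ := nextPrime_spec c.p
  have h2 := hp.trans hle
  refine .arith 2 rfl (by omega) ?_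
  obtain ⟨c', hr, ⟨P, d, r, rfl, hP, hP', hd, hdP, hdvd⟩, hnt⟩ :=
    Runs.loop_of_measure (e := e) (M := M) (t := .lt (.reg .t) (.reg .p)) (p := block [
      assign .tmp .mod (.reg .p) (.reg .t),
      .ite (.eq (.reg .tmp) (.const 0))
        (block [assign .p .add (.reg .p) (.const 1), assign .t .add (.const 2) (.const 0)])
        (block [assign .t .add (.reg .t) (.const 1)])])
    -- The candidate `P` never passes `nextPrime c.p`, and no number from `2` to `d - 1` divides it.
    (fun c' => ∃ P d r, c' = { c with p := P, t := d, tmp := r } ∧ c.p ≤ P ∧ P ≤ nextPrime c.p ∧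
      2 ≤ d ∧ d ≤ P ∧ ∀ k, 2 ≤ k → k < d → ¬ k ∣ P)
    -- A lexicographic measure in one number: raising the candidate outweighs resetting the trial
    -- divisor to `2`.
    (fun c' => (nextPrime c.p + 1 - c'.p) * (nextPrime c.p + 2) - c'.t)
    (fun c' ⟨P, d, r, hc', hP, hP', hd, hdP, hdvd⟩ ht => by
      subst hc'
      replace ht : d < P := ht
      have hr : P % d ≤ M := (Nat.mod_lt _ (by omega)).le.trans (by omega)
      by_cases h0 : P % d = 0
      · have hne : P ≠ nextPrime c.p := by
          rintro rfl
          have := (Nat.dvd_prime hpr).1 (Nat.dvd_of_mod_eq_zero h0)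
          omega
        refine ⟨{ c with p := P + 1, t := 2, tmp := P % d }, ?_, ⟨P + 1, 2, P % d, rfl, by omega,
          by omega, le_rfl, by omega, fun k _ _ => by omega⟩, ?_⟩
        · exact .arith (P % d) rfl hr (.cons (.iteTrue h0
            (.arith (P + 1) rfl (by omega) (.arith 2 rfl (by omega) (.nil rfl)))) (.nil rfl))
        · change (nextPrime c.p + 1 - (P + 1)) * (nextPrime c.p + 2) - 2 <
            (nextPrime c.p + 1 - P) * (nextPrime c.p + 2) - d
          rw [show nextPrime c.p + 1 - P = nextPrime c.p + 1 - (P + 1) + 1 by omega, add_mul]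
          omega
      · refine ⟨{ c with p := P, t := d + 1, tmp := P % d }, ?_, ⟨P, d + 1, P % d, rfl, hP, hP',
          by omega, ht, fun k hk hkd => ?_⟩, ?_⟩
        · exact .arith (P % d) rfl hr (.cons (.iteFalse h0
            (.arith (d + 1) rfl (by omega) (.nil rfl))) (.nil rfl))
        · obtain h | rfl := Nat.lt_succ_iff_lt_or_eq.1 hkd
          · exact hdvd k hk h
          · exact fun h => h0 (Nat.mod_eq_zero_of_dvd h)
        · change (nextPrime c.p + 1 - P) * (nextPrime c.p + 2) - (d + 1) <
            (nextPrime c.p + 1 - P) * (nextPrime c.p + 2) - d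
          rw [show nextPrime c.p + 1 - P = nextPrime c.p - P + 1 by omega, add_mul]
          omega)
    { c with t := 2 }
    ⟨c.p, 2, c.tmp, rfl, le_rfl, hle, le_rfl, hp, fun k _ _ => by omega⟩
  refine .cons hr (.arith 0 rfl (by omega) (.arith 0 rfl (by omega) (.nil ?_)))
  replace hnt : ¬ d < P := hnt
  have hPp : P.Prime := Nat.prime_def_lt'.2 ⟨by omega, fun k hk hkP => hdvd k hk (by omega)⟩
  obtain rfl : P = nextPrime c.p := le_antisymm hP' (nextPrime_le hP hPp)
  ext1 <;> first | rfl | (symm; assumption)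

end

/-! ### Binary words. -/

/-- The number with the `k` binary digits `f 0, …, f (k - 1)`, most significant first. -/
def binVal (f : ℕ → Bool) : ℕ → ℕ
  | 0 => 0
  | k + 1 => binVal f k * 2 + (f k).toNat

theorem binVal_lt (f : ℕ → Bool) (k : ℕ) : binVal f k < 2 ^ k := by
  induction k with
  | zero => simp [binVal]
  | succ k ih =>
    have := Bool.toNat_le (f k)
    rw [binVal, pow_succ]
    omega

theorem binVal_congr {f g : ℕ → Bool} {k : ℕ} (h : ∀ i < k, f i = g i) :
    binVal f k = binVal g k := by
  induction k with
  | zero => rfl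
  | succ k ih => rw [binVal, binVal, ih fun i hi => h i (by omega), h k (by omega)]

theorem eq_of_binVal_eq {f g : ℕ → Bool} {k : ℕ} (h : binVal f k = binVal g k) :
    ∀ i < k, f i = g i := by
  induction k with
  | zero => simp
  | succ k ih =>
    have h₁ := Bool.toNat_le (f k)
    have h₂ := Bool.toNat_le (g k)
    rw [binVal, binVal] at h
    intro i hi
    obtain hi | rfl := Nat.lt_succ_iff_lt_or_eq.1 hi
    · exact ih (by omega) i hi
    · have h₃ : (f i).toNat = (g i).toNat := by omega
      revert h₃
      cases f i <;> cases g i <;> simp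

theorem exists_binVal_eq {v k : ℕ} (h : v < 2 ^ k) : ∃ f, binVal f k = v := by
  induction k generalizing v with
  | zero => exact ⟨fun _ => false, by simp [binVal]; omega⟩
  | succ k ih =>
    obtain ⟨f, hf⟩ := ih (v := v / 2) (by rw [pow_succ] at h; omega)
    refine ⟨fun i => if i = k then decide (v % 2 = 1) else f i, ?_⟩
    rw [binVal, binVal_congr (g := f) fun i hi => if_neg hi.ne, hf, if_pos rfl]
    rcases Nat.mod_two_eq_zero_or_one v with h | h <;> simp [h] <;> omega

/-! ### Parameters of the protocol -/

/-- The number of bits of `m + n`, at least `1`. -/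
def logSize (m n : ℕ) : ℕ := Nat.log 2 (m + n) + 1

/-- Capping `w` keeps the degree bounds polynomial in `n` when `w` is huge; the cap `n + 1` stays
positive for `n = 0`. -/
def width (n w : ℕ) : ℕ := if w < n + 1 then w else n + 1

def height (n w : ℕ) : ℕ := n / width n w + 1

/-- One sampling rate `2 ^ -(u + 1)` for each `u ≤ logSize m n`, enough for every possible number of
occurrences. -/
def levels (m n : ℕ) : ℕ := logSize m n + 1

/-- Slots per row: every trial is used at every level. This is also the number of factors in the
product of a row. -/
def factors (m n : ℕ) : ℕ := (logSize m n + 3) * 6 * levels m n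

def slots (m n w : ℕ) : ℕ := height n w * factors m n

/-- A product of `factors` polynomials of degree at most `width` is determined by this many values.
-/
def nodes (m n w : ℕ) : ℕ := factors m n * width n w + 1

def wordLen (m n : ℕ) : ℕ := logSize m n * 10

noncomputable def modulus (m n : ℕ) : ℕ := nextPrime (2 ^ wordLen m n)

instance (m n : ℕ) : Fact (modulus m n).Prime := ⟨(nextPrime_spec _).2⟩

section

variable (m n w : ℕ)

theorem logSize_pos : 0 < logSize m n := Nat.succ_pos _

theorem lt_two_pow_logSize : m + n < 2 ^ logSize m n := Nat.lt_pow_succ_log_self one_lt_two _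

theorem width_le : width n w ≤ n + 1 := by
  unfold width
  split <;> omega

variable {w} in
theorem width_le_self : width n w ≤ w := by
  unfold width
  split <;> omega

variable {w} in
theorem width_pos (hw : 0 < w) : 0 < width n w := by
  unfold width
  split <;> omega

theorem height_le : height n w ≤ n + 1 := Nat.succ_le_succ (Nat.div_le_self _ _)

variable {n w} in
theorem height_le_two_mul {s : ℕ} (hs : 0 < s) (h : n ≤ s * w) :
    height n w ≤ 2 * s := by
  unfold height width
  split
  · have := Nat.div_le_of_le_mul (h.trans_eq (mul_comm s w))
    omega
  · rw [Nat.div_eq_of_lt (by omega)]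
    omega

theorem factors_le : factors m n ≤ 48 * logSize m n ^ 2 := by
  have := logSize_pos m n
  unfold factors levels
  nlinarith

theorem two_pow_wordLen : 2 ^ wordLen m n = (2 ^ logSize m n) ^ 10 := by
  rw [wordLen, pow_mul]

theorem two_pow_wordLen_le : 2 ^ wordLen m n ≤ modulus m n := (nextPrime_spec _).1

theorem modulus_le : modulus m n ≤ 2 * 2 ^ wordLen m n := nextPrime_le_two_mul (by positivity)

theorem two_le_two_pow_logSize : 2 ≤ 2 ^ logSize m n :=
  (pow_le_pow_right₀ one_le_two (logSize_pos m n)).trans_eq' rfl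

theorem two_pow_logSize_pow_le : (2 ^ logSize m n) ^ 10 ≤ modulus m n :=
  (two_pow_wordLen m n) ▸ two_pow_wordLen_le m n

theorem two_pow_logSize_pow_le' {j : ℕ} (h : j ≤ 10) : (2 ^ logSize m n) ^ j ≤ modulus m n :=
  (pow_le_pow_right₀ (by linarith [two_le_two_pow_logSize m n]) h).trans
    (two_pow_logSize_pow_le m n)

/-- Crude bounds by powers of `2 ^ logSize m n` reduce the comparisons with the modulus to comparing
exponents with `10`. -/
theorem factors_le_pow : factors m n ≤ (2 ^ logSize m n) ^ 6 := by
  have h₁ : logSize m n ≤ 2 ^ Nat.log 2 (m + n) := Nat.lt_two_pow_self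
  have h₂ : 2 ^ logSize m n = 2 * 2 ^ Nat.log 2 (m + n) := by rw [logSize, pow_succ']
  have h₃ := two_le_two_pow_logSize m n
  have h₄ : 2 ^ 4 ≤ (2 ^ logSize m n) ^ 4 := pow_le_pow_left₀ (by omega) h₃ 4
  calc factors m n ≤ 48 * logSize m n ^ 2 := factors_le m n
    _ ≤ 48 * (2 ^ Nat.log 2 (m + n)) ^ 2 := by gcongr
    _ = 12 * (2 ^ logSize m n) ^ 2 := by rw [h₂]; ring
    _ ≤ (2 ^ logSize m n) ^ 4 * (2 ^ logSize m n) ^ 2 := Nat.mul_le_mul_right _ (by omega)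
    _ = _ := by ring

theorem succ_le_two_pow_logSize : n + 1 ≤ 2 ^ logSize m n := by
  have := lt_two_pow_logSize m n
  omega

theorem slots_le_pow : slots m n w ≤ (2 ^ logSize m n) ^ 7 :=
  (Nat.mul_le_mul ((height_le n w).trans (succ_le_two_pow_logSize m n))
    (factors_le_pow m n)).trans_eq (by ring)

theorem mul_slots_le_pow : m * slots m n w ≤ (2 ^ logSize m n) ^ 8 :=
  (Nat.mul_le_mul (show m ≤ 2 ^ logSize m n by linarith [lt_two_pow_logSize m n])
    (slots_le_pow m n w)).trans_eq
    (by ring)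

theorem nodes_le_pow : nodes m n w ≤ (2 ^ logSize m n) ^ 7 + 1 :=
  Nat.succ_le_succ ((Nat.mul_le_mul (factors_le_pow m n)
    ((width_le n w).trans (succ_le_two_pow_logSize m n))).trans_eq (by ring))

/-- Soundness in numbers: a nonzero polynomial of degree at most `nodes - 1` vanishes at fewer than
one sixth of the `2 ^ wordLen` possible points. -/
theorem six_mul_nodes_lt : 6 * (nodes m n w - 1) < 2 ^ wordLen m n := by
  have h₁ := nodes_le_pow m n w
  have h₃ := two_le_two_pow_logSize m n
  have h₄ : 2 ^ 3 ≤ (2 ^ logSize m n) ^ 3 := pow_le_pow_left₀ (by omega) h₃ 3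
  have h₅ : 0 < (2 ^ logSize m n) ^ 7 := by positivity
  rw [two_pow_wordLen, show 10 = 7 + 3 from rfl, pow_add]
  nlinarith [show nodes m n w - 1 ≤ (2 ^ logSize m n) ^ 7 by omega]

theorem nodes_lt_modulus : nodes m n w < modulus m n := by
  have h₁ := six_mul_nodes_lt m n w
  have h₂ := two_pow_wordLen_le m n
  have h₃ := two_pow_logSize_pow_le' m n (j := 1) (by omega)
  have h₄ : 2 ^ 10 ≤ (2 ^ logSize m n) ^ 10 :=
    pow_le_pow_left₀ (by omega) (two_le_two_pow_logSize m n) 10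
  rw [← two_pow_wordLen] at h₄
  omega

theorem add_lt_modulus : m + n < modulus m n :=
  (lt_two_pow_logSize m n).trans_le ((pow_one _).symm.le.trans
    (two_pow_logSize_pow_le' m n (by omega)))

theorem slots_le_modulus : slots m n w ≤ modulus m n :=
  (slots_le_pow m n w).trans (two_pow_logSize_pow_le' m n (by omega))

theorem mul_slots_le_modulus : m * slots m n w ≤ modulus m n :=
  (mul_slots_le_pow m n w).trans (two_pow_logSize_pow_le' m n (by omega))

theorem factors_le_modulus : factors m n ≤ modulus m n :=
  (factors_le_pow m n).trans (two_pow_logSize_pow_le' m n (by omega))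

theorem wordLen_lt_modulus : wordLen m n < modulus m n :=
  Nat.lt_two_pow_self.trans_le (two_pow_wordLen_le m n)

end

/-! ### Setup: parameters, the secret point, the modulus. -/

/-- Computes the parameters of the protocol that do not depend on the prime. -/
def parameterCode : Cmd Reg :=
  block [
    assign .tmp .add .m .n,
    assign .tmp .add (.reg .tmp) (.const 1),
    assign .q .add (.const 2) (.const 0),
    assign .lam .add (.const 1) (.const 0),
    .loop (.lt (.reg .q) (.reg .tmp)) (block [
      assign .q .mul (.reg .q) (.const 2),
      assign .lam .add (.reg .lam) (.const 1)]),
    assign .q .add (.const 0) (.const 0),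
    assign .tmp .add (.const 0) (.const 0),
    assign .wd .add .n (.const 1),
    .ite (.lt .w (.reg .wd)) (block [assign .wd .add .w (.const 0)]) (block []),
    assign .ht .div .n (.reg .wd),
    assign .ht .add (.reg .ht) (.const 1),
    assign .U .add (.reg .lam) (.const 1),
    assign .G .add (.reg .lam) (.const 3),
    assign .G .mul (.reg .G) (.const 6),
    assign .G .mul (.reg .G) (.reg .U),
    assign .K .mul (.reg .ht) (.reg .G),
    assign .D .mul (.reg .G) (.reg .wd),
    assign .D .add (.reg .D) (.const 1),
    assign .B .mul (.reg .lam) (.const 10)]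

/-- `xi :=` a number below `2 ^ B` made of fresh coin tosses, and `p := 2 ^ B` -/
def coinCode : Cmd Reg :=
  block [
    assign .p .add (.const 1) (.const 0),
    forLoop .k (.reg .B) (block [
      .instr (.toss .t),
      assign .xi .mul (.reg .xi) (.const 2),
      assign .xi .add (.reg .xi) (.reg .t),
      assign .p .mul (.reg .p) (.const 2),
      assign .t .add (.const 0) (.const 0)])]

def setupCode : Cmd Reg :=
  block [parameterCode, coinCode, nextPrimeCode, assign .bs .mul (.reg .p) (.reg .p)]

section

variable {e : Env} {M : ℕ}

/-- The configuration in which the parameters have been computed. -/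
def paramConf (e : Env) (input : List ℕ) (proof coins : List Bool) : Conf where
  lam := logSize e.m e.n
  wd := width e.n e.w
  ht := height e.n e.w
  U := levels e.m e.n
  G := factors e.m e.n
  K := slots e.m e.n e.w
  D := nodes e.m e.n e.w
  B := wordLen e.m e.n
  input := input
  proof := proof
  coins := coins

theorem parameter_runs (hM : 2 * modulus e.m e.n ≤ M) (input : List ℕ)
    (proof coins : List Bool) :
    Runs e M parameterCode { input := input, proof := proof, coins := coins }
      (paramConf e input proof coins) := by
  have h₁ := add_lt_modulus e.m e.n
  have h₂ := two_pow_logSize_pow_le' e.m e.n (j := 1) (by omega)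
  rw [pow_one] at h₂
  have h₃ : logSize e.m e.n < 2 ^ logSize e.m e.n := Nat.lt_two_pow_self
  have h₄ := (width_le e.n e.w)
  have h₅ := (height_le e.n e.w)
  have h₆ := factors_le_modulus e.m e.n
  have h₇ := slots_le_modulus e.m e.n e.w
  have h₈ := nodes_lt_modulus e.m e.n e.w
  have h₉ := wordLen_lt_modulus e.m e.n
  have hG : (logSize e.m e.n + 3) * 6 ≤ factors e.m e.n :=
    Nat.le_mul_of_pos_right _ (by simp [levels])
  refine .arith (e.m + e.n) rfl (by omega) ?_
  refine .arith (e.m + e.n + 1) rfl (by omega) ?_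
  refine .arith 2 rfl (by omega) ?_
  refine .arith 1 rfl (by omega) ?_
  dsimp only [Conf.put]
  refine .cons (c' := {
    tmp := e.m + e.n + 1, q := 2 ^ logSize e.m e.n, lam := logSize e.m e.n,
    input := input, proof := proof, coins := coins }) ?_ ?_
  · refine .loop (fun k => {
      tmp := e.m + e.n + 1, q := 2 ^ (k + 1), lam := k + 1,
      input := input, proof := proof, coins := coins }) (Nat.log 2 (e.m + e.n))
      (fun k hk => ?_) ?_ fun k hk => ?_
    · change 2 ^ (k + 1) < e.m + e.n + 1
      exact Nat.lt_succ_of_le (Nat.pow_le_of_le_log (by rintro h; simp [h] at hk) hk)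
    · change ¬ 2 ^ (Nat.log 2 (e.m + e.n) + 1) < e.m + e.n + 1
      have : e.m + e.n < 2 ^ (Nat.log 2 (e.m + e.n) + 1) := lt_two_pow_logSize e.m e.n
      omega
    · have h : 2 ^ (k + 1 + 1) ≤ 2 ^ logSize e.m e.n :=
        pow_le_pow_right₀ one_le_two (Nat.succ_le_succ hk)
      have hk' : k + 1 + 1 ≤ logSize e.m e.n := Nat.succ_le_succ hk
      exact .arith (2 ^ (k + 1 + 1)) rfl (by omega) (.arith (k + 1 + 1) rfl (by omega) (.nil rfl))
  refine .arith 0 rfl (by omega) ?_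
  refine .arith 0 rfl (by omega) ?_
  refine .arith (e.n + 1) rfl (by omega) ?_
  dsimp only [Conf.put]
  refine .cons (c' := {
    wd := width e.n e.w, lam := logSize e.m e.n,
    input := input, proof := proof, coins := coins }) ?_ ?_
  · unfold width
    split
    · next h => exact .iteTrue h (.arith _ rfl (by change e.w ≤ M; omega) (.nil rfl))
    · next h => exact .iteFalse h (.nil rfl)
  refine .arith (e.n / width e.n e.w) rfl ((Nat.div_le_self _ _).trans (by omega)) ?_
  refine .arith (height e.n e.w) rfl (by omega) ?_
  refine .arith (levels e.m e.n) rfl (by rw [levels]; omega) ?_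
  dsimp only [Conf.put]
  refine .arith (logSize e.m e.n + 3) rfl (by omega) ?_
  refine .arith ((logSize e.m e.n + 3) * 6) rfl (by omega) ?_
  refine .arith (factors e.m e.n) rfl (by omega) ?_
  dsimp only [Conf.put]
  refine .arith (slots e.m e.n e.w) rfl (by omega) ?_
  refine .arith (factors e.m e.n * width e.n e.w) rfl
    (h₈.le.trans' (Nat.le_succ _) |>.trans (by omega)) ?_
  dsimp only [Conf.put]
  refine .arith (nodes e.m e.n e.w) rfl (by omega) ?_
  refine .arith (wordLen e.m e.n) rfl (by omega) (.nil rfl)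

theorem coin_runs (hM : 2 * modulus e.m e.n ≤ M) (input : List ℕ) (proof : List Bool)
    (ρ : Fin (wordLen e.m e.n) → Bool) :
    Runs e M coinCode (paramConf e input proof (List.ofFn ρ))
      { paramConf e input proof [] with
        xi := binVal (fun i => (List.ofFn ρ).getD i false) (wordLen e.m e.n)
        p := 2 ^ wordLen e.m e.n } := by
  have h₁ := add_lt_modulus e.m e.n
  have h₂ := two_pow_wordLen_le e.m e.n
  have h₉ := wordLen_lt_modulus e.m e.n
  set f := fun i => (List.ofFn ρ).getD i false with hf
  refine .arith 1 rfl (by omega) (.cons (.forLoop (fun k =>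
    { paramConf e input proof ((List.ofFn ρ).drop k) with xi := binVal f k, p := 2 ^ k, k := k })
    (wordLen e.m e.n) (fun _ _ => rfl) (fun _ _ => rfl) (by omega) rfl rfl fun k hk => ?_)
    (.nil ?_))
  · have hlt := binVal_lt f (k + 1)
    rw [binVal] at hlt
    have hle : 2 ^ (k + 1) ≤ 2 ^ wordLen e.m e.n := pow_le_pow_right₀ one_le_two hk
    refine ⟨{ paramConf e input proof ((List.ofFn ρ).drop (k + 1)) with
      xi := binVal f (k + 1), p := 2 ^ (k + 1), k := k }, ?_, rfl, rfl⟩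
    have hd : (List.ofFn ρ).drop k = f k :: (List.ofFn ρ).drop (k + 1) := by
      rw [List.drop_eq_getElem_cons (by simpa using hk)]
      simp [hf, hk]
    have hb := Bool.toNat_le (f k)
    refine .toss hd (by omega) ?_
    dsimp only [Conf.put]
    refine .arith (binVal f k * 2) rfl (by omega) ?_
    refine .arith (binVal f (k + 1)) rfl (by rw [binVal]; omega) ?_
    dsimp only [Conf.put]
    refine .arith (2 ^ (k + 1)) rfl (by omega) ?_
    exact .arith 0 rfl (by omega) (.nil rfl)
  · dsimp only [Conf.put]
    rw [List.drop_eq_nil_of_le (by simp)]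
    rfl

/-- The base of the numbers in `acc`. -/
noncomputable def base (e : Env) : ℕ := modulus e.m e.n * modulus e.m e.n

/-- The configuration after the setup, with `x` the number made of the private coins. -/
noncomputable def setupConf (e : Env) (x : ℕ) (input : List ℕ) (proof : List Bool) : Conf :=
  { paramConf e input proof [] with
    xi := x
    p := modulus e.m e.n
    bs := base e }

theorem setup_runs (hM : 2 * modulus e.m e.n * modulus e.m e.n ≤ M) (input : List ℕ)
    (proof : List Bool) (ρ : Fin (wordLen e.m e.n) → Bool) :
    Runs e M setupCode { input := input, proof := proof, coins := List.ofFn ρ }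
      (setupConf e (binVal (fun i => (List.ofFn ρ).getD i false) (wordLen e.m e.n))
        input proof) := by
  have hp : 2 ≤ modulus e.m e.n := (Fact.out : (modulus e.m e.n).Prime).two_le
  have hM' : 2 * modulus e.m e.n ≤ M := by nlinarith
  refine .cons (parameter_runs hM' _ _ _) (.cons (coin_runs hM' _ _ _) (.cons
    (nextPrime_runs _ ?_ rfl rfl ?_) (.arith _ rfl ?_ (.nil rfl))))
  · change 2 ^ 1 ≤ 2 ^ wordLen e.m e.n
    exact pow_le_pow_right₀ one_le_two (by rw [wordLen]; have := logSize_pos e.m e.n; omega)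
  · change modulus e.m e.n ≤ M
    omega
  · change modulus e.m e.n * modulus e.m e.n ≤ M
    nlinarith

end

/-! ### The pass over the input stream. -/

/-- Treats slot `k` for an element of the stream in row `y`. -/
def slotCode : Cmd Reg :=
  block [
    -- `b` is the running product of the random bits of the current trial and restarts at each
    -- multiple of `U`. The bits of all rows are scanned, so `pos` does not depend on the element
    -- read.
    assign .t .mod (.reg .k) (.reg .U),
    .ite (.eq (.reg .t) (.const 0)) (block [assign .b .add (.const 1) (.const 0)]) (block []),
    .instr (.query .t (.reg .pos)),
    assign .b .mul (.reg .b) (.reg .t),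
    assign .t .div (.reg .k) (.reg .G),
    .ite (.eq (.reg .t) (.reg .y))
      (block [
        assign .tmp .mul (.reg .lag) (.reg .b),
        assign .tmp .mul (.reg .tmp) (.reg .z),
        assign .acc .add (.reg .acc) (.reg .tmp),
        assign .tmp .add (.const 0) (.const 0)])
      (block []),
    assign .z .mul (.reg .z) (.reg .bs),
    assign .pos .add (.reg .pos) (.const 1),
    assign .t .add (.const 0) (.const 0)]

/-- Reads the input stream. The register `acc` holds one number in base `bs` for every slot. -/
def inputCode : Cmd Reg :=
  forLoop .i .m (block [
    .instr (.readInput .x),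
    assign .tmp .sub (.reg .x) (.const 1),
    assign .x .mod (.reg .tmp) (.reg .wd),
    assign .y .div (.reg .tmp) (.reg .wd),
    assign .tmp .add (.const 0) (.const 0),
    assign .nn .add (.reg .wd) (.const 0),
    lagrangeCode,
    assign .z .add (.const 1) (.const 0),
    forLoop .k (.reg .K) slotCode,
    assign .z .add (.const 0) (.const 0),
    assign .b .add (.const 0) (.const 0),
    assign .x .add (.const 0) (.const 0),
    assign .y .add (.const 0) (.const 0),
    assign .nn .add (.const 0) (.const 0),
    assign .lag .add (.const 0) (.const 0)])

/-- Whether the common random bits at `o + k` and before it, back to the last multiple of `U`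
(counted from `o`), are all `1`. -/
def chainBit (r : ℕ → Bool) (U o k : ℕ) : ℕ :=
  if ∀ u ≤ k % U, r (o + k - u) = true then 1 else 0

theorem chainBit_le (r : ℕ → Bool) (U o k : ℕ) : chainBit r U o k ≤ 1 := by
  unfold chainBit
  split <;> omega

theorem chainBit_zero (r : ℕ → Bool) (U o k : ℕ) (h : k % U = 0) :
    1 * (r (o + k)).toNat = chainBit r U o k := by
  simp only [chainBit, h, nonpos_iff_eq_zero, forall_eq, Nat.sub_zero]
  cases r (o + k) <;> rfl

theorem chainBit_succ (r : ℕ → Bool) (U o k : ℕ) (h : (k + 1) % U ≠ 0) :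
    chainBit r U o k * (r (o + (k + 1))).toNat = chainBit r U o (k + 1) := by
  have hU : (k + 1) % U = k % U + 1 := by
    rcases Nat.eq_zero_or_pos U with rfl | hU
    · simp
    · have := Nat.mod_lt k hU
      rw [Nat.add_mod] at h ⊢
      rcases Nat.lt_or_ge 1 U with h1 | h1
      · rw [Nat.mod_eq_of_lt h1] at h ⊢
        refine Nat.mod_eq_of_lt (lt_of_le_of_ne this fun h' => h ?_)
        rw [show k % U + 1 = U from h', Nat.mod_self]
      · obtain rfl : U = 1 := by omega
        simp [Nat.mod_one] at h
  have : (∀ u ≤ (k + 1) % U, r (o + (k + 1) - u) = true) ↔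
      (∀ u ≤ k % U, r (o + k - u) = true) ∧ r (o + (k + 1)) = true := by
    rw [hU]
    constructor
    · refine fun H => ⟨fun u hu => ?_, H 0 (by omega)⟩
      have := H (u + 1) (by omega)
      rwa [show o + (k + 1) - (u + 1) = o + k - u by omega] at this
    · rintro ⟨H, H'⟩ (_ | u) hu
      · exact H'
      · rw [show o + (k + 1) - (u + 1) = o + k - u by omega]
        exact H u (by omega)
  unfold chainBit
  simp only [this]
  cases r (o + (k + 1)) <;> simp

theorem sum_mul_pow_lt {d : ℕ → ℕ} {b K : ℕ} (h : ∀ k < K, d k < b) :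
    ∑ k ∈ Finset.range K, d k * b ^ k < b ^ K := by
  induction K with
  | zero => simp
  | succ K ih =>
    rw [Finset.sum_range_succ, pow_succ']
    have h₁ := ih fun k hk => h k (by omega)
    have h₂ : (d K + 1) * b ^ K ≤ b * b ^ K := Nat.mul_le_mul_right _ (h K (by omega))
    linarith

section

variable {e : Env} {M : ℕ}

/-- The `i`-th element of the stream, numbered from `0`. -/
def elt {m n : ℕ} (σ : Fin m → Fin n) (i : ℕ) : ℕ := if h : i < m then σ ⟨i, h⟩ else 0

theorem drop_ofFn_eq {m n : ℕ} (σ : Fin m → Fin n) {i : ℕ} (hi : i < m) :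
    (List.ofFn fun i => (σ i : ℕ) + 1).drop i =
      (elt σ i + 1) :: (List.ofFn fun i => (σ i : ℕ) + 1).drop (i + 1) := by
  rw [List.drop_eq_getElem_cons (by simpa using hi)]
  simp [elt, hi]

/-- The value at the random point `x` of the indicator polynomial of the column of `a`. -/
noncomputable def weight (e : Env) (x a : ℕ) : ℕ :=
  ((lagr (modulus e.m e.n) (width e.n e.w) (a % width e.n e.w)).eval
    (x : ZMod (modulus e.m e.n))).val

/-- What the occurrence of `a` as the `i`-th element adds to slot `k`. -/
noncomputable def contrib (e : Env) (x a i k : ℕ) : ℕ :=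
  if k / factors e.m e.n = a / width e.n e.w then
    weight e x a * chainBit e.r (levels e.m e.n) (i * slots e.m e.n e.w) k
  else 0

theorem weight_lt (e : Env) (x a : ℕ) : weight e x a < modulus e.m e.n := ZMod.val_lt _

theorem contrib_le (e : Env) (x a i k : ℕ) : contrib e x a i k ≤ modulus e.m e.n := by
  unfold contrib
  split
  · exact (Nat.mul_le_mul (weight_lt e x a).le (chainBit_le _ _ _ _)).trans_eq (mul_one _)
  · exact Nat.zero_le _

/-- The content of slot `k` after `i` elements of the stream. -/
noncomputable def slot (e : Env) (x : ℕ) (σ : Fin e.m → Fin e.n) (i k : ℕ) : ℕ :=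
  ∑ j ∈ Finset.range i, contrib e x (elt σ j) j k

/-- Slots are not reduced during the pass. Each receives at most `m` contributions of size at most
`p`, and `m < p`, so a digit in base `p * p` never overflows into the next. -/
theorem slot_lt (x : ℕ) (σ : Fin e.m → Fin e.n) {i : ℕ} (hi : i ≤ e.m) (k : ℕ) :
    slot e x σ i k < base e := by
  have h₁ := add_lt_modulus e.m e.n
  calc slot e x σ i k ≤ ∑ _j ∈ Finset.range i, modulus e.m e.n :=
        Finset.sum_le_sum fun j _ => contrib_le e x _ j k
    _ = i * modulus e.m e.n := by simp
    _ < _ := Nat.mul_lt_mul_of_pos_right (by omega) (by omega)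

/-- The content of `acc` after `i` elements of the stream. -/
noncomputable def accum (e : Env) (x : ℕ) (σ : Fin e.m → Fin e.n) (i : ℕ) : ℕ :=
  ∑ k ∈ Finset.range (slots e.m e.n e.w),
    slot e x σ i k * base e ^ k

theorem accum_lt (x : ℕ) (σ : Fin e.m → Fin e.n) {i : ℕ} (hi : i ≤ e.m) :
    accum e x σ i < base e ^ slots e.m e.n e.w :=
  sum_mul_pow_lt fun k _ => slot_lt x σ hi k

theorem accum_succ (x : ℕ) (σ : Fin e.m → Fin e.n) (i : ℕ) :
    accum e x σ (i + 1) = accum e x σ i + ∑ k ∈ Finset.range (slots e.m e.n e.w),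
      contrib e x (elt σ i) i k * base e ^ k := by
  simp only [accum, slot, Finset.sum_range_succ, add_mul, Finset.sum_add_distrib]

/-- The content of `b` before step `k` of the inner loop. -/
def prevBit (r : ℕ → Bool) (U o : ℕ) : ℕ → ℕ
  -- The reset content of the register; slot `0` starts a trial and overwrites it.
  | 0 => 0
  | k + 1 => chainBit r U o k

theorem prevBit_step (r : ℕ → Bool) (U o k : ℕ) :
    (if k % U = 0 then 1 else prevBit r U o k) * (r (o + k)).toNat = chainBit r U o k := by
  split
  · next h => exact chainBit_zero r U o k h
  · next h =>
    cases k with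
    | zero => exact absurd (Nat.zero_mod U) h
    | succ k => exact chainBit_succ r U o k h

theorem prevBit_le (r : ℕ → Bool) (U o k : ℕ) : prevBit r U o k ≤ 1 := by
  cases k with
  | zero => exact Nat.zero_le _
  | succ k => exact chainBit_le r U o k

end

section

variable {e : Env} {M : ℕ}


/-- The configuration in the inner loop of `inputCode`, before step `k`, with `A` in `acc`. -/
noncomputable def slotConf (e : Env) (x a i A : ℕ) (input : List ℕ) (proof : List Bool) (k : ℕ) :
    Conf :=
  { setupConf e x input proof with
    i := i
    x := a % width e.n e.w
    y := a / width e.n e.w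
    nn := width e.n e.w
    lag := weight e x a
    z := base e ^ k
    b := prevBit e.r (levels e.m e.n) (i * slots e.m e.n e.w) k
    acc := A
    pos := i * slots e.m e.n e.w + k
    k := k }

theorem slot_step_runs (hM : base e ^ (slots e.m e.n e.w + 2) ≤ M) (x a i A : ℕ) (input : List ℕ)
    (proof : List Bool) (k : ℕ) (hi : i < e.m) (hk : k < slots e.m e.n e.w)
    (hA : A + contrib e x a i k * base e ^ k ≤ M) :
    Runs e M slotCode
      (slotConf e x a i A input proof k)
      { slotConf e x a i (A + contrib e x a i k * base e ^ k) input proof (k + 1) with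
        k := k } := by
  have hp : 2 ≤ modulus e.m e.n := (Fact.out : (modulus e.m e.n).Prime).two_le
  have hp2 : 4 ≤ base e := by unfold base; nlinarith
  have hpb : modulus e.m e.n ≤ base e := Nat.le_mul_self _
  have hbM : base e ^ (k + 1) ≤ M := (Nat.pow_le_pow_right (by omega) (by omega)).trans hM
  have hpM : modulus e.m e.n ≤ M := hpb.trans ((Nat.le_self_pow (by omega) _).trans hM)
  have hsM := slots_le_modulus e.m e.n e.w
  have hmsM := mul_slots_le_modulus e.m e.n e.w
  have hpos : i * slots e.m e.n e.w + k + 1 ≤ e.m * slots e.m e.n e.w := by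
    have := Nat.mul_le_mul_right (slots e.m e.n e.w) (Nat.succ_le_of_lt hi)
    rw [Nat.succ_mul] at this
    omega
  obtain ⟨β, hβ⟩ : ∃ β, chainBit e.r (levels e.m e.n) (i * slots e.m e.n e.w) k = β := ⟨_, rfl⟩
  have hβ1 : β ≤ 1 := hβ ▸ chainBit_le _ _ _ _
  obtain ⟨B, hB⟩ : ∃ B, prevBit e.r (levels e.m e.n) (i * slots e.m e.n e.w) k = B := ⟨_, rfl⟩
  have hstep := prevBit_step e.r (levels e.m e.n) (i * slots e.m e.n e.w) k
  have hB1 : B ≤ 1 := hB ▸ prevBit_le _ _ _ _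
  rw [hβ, hB] at hstep
  have hnext : prevBit e.r (levels e.m e.n) (i * slots e.m e.n e.w) (k + 1) = β := hβ
  obtain ⟨W, hW⟩ : ∃ W, weight e x a = W := ⟨_, rfl⟩
  have hWM : W < modulus e.m e.n := hW ▸ weight_lt e x a
  unfold contrib at hA ⊢
  simp only [slotConf, hB, hβ, hW, hnext] at hA ⊢
  simp only [setupConf, paramConf]
  refine .arith (k % levels e.m e.n) rfl ((Nat.mod_le _ _).trans (by omega)) ?_
  dsimp only [Conf.put]
  refine .cons (c' := { setupConf e x input proof with
    i := i
    x := a % width e.n e.w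
    y := a / width e.n e.w
    nn := width e.n e.w
    lag := W
    z := base e ^ k
    b := if k % levels e.m e.n = 0 then 1 else B
    acc := A
    pos := i * slots e.m e.n e.w + k
    k := k
    t := k % levels e.m e.n }) ?_ ?_
  · simp only [setupConf, paramConf]
    split
    · next h => exact .iteTrue h (.arith 1 rfl (by omega) (.nil rfl))
    · next h => exact .iteFalse h (.nil rfl)
  simp only [setupConf, paramConf]
  have hr := Bool.toNat_le (e.r (i * slots e.m e.n e.w + k))
  refine .query _ rfl (hr.trans (by omega)) ?_
  dsimp only [Conf.put]
  refine .arith β hstep (by omega) ?_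
  refine .arith (k / factors e.m e.n) rfl ((Nat.div_le_self _ _).trans (by omega)) ?_
  dsimp only [Conf.put]
  have hW1 : W * β ≤ modulus e.m e.n := (Nat.mul_le_mul hWM.le hβ1).trans_eq (mul_one _)
  have hW2 : W * β * base e ^ k ≤ base e ^ (k + 1) := by
    rw [pow_succ']
    exact Nat.mul_le_mul_right _ (hW1.trans hpb)
  refine .cons (c' := { setupConf e x input proof with
    i := i
    x := a % width e.n e.w
    y := a / width e.n e.w
    nn := width e.n e.w
    lag := W
    z := base e ^ k
    b := β
    acc := A + (if k / factors e.m e.n = a / width e.n e.w then W * β else 0) * base e ^ k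
    pos := i * slots e.m e.n e.w + k
    k := k
    t := k / factors e.m e.n }) ?_ ?_
  · simp only [setupConf, paramConf]
    split
    · next h =>
      rw [if_pos h] at hA
      refine .iteTrue h (.arith (W * β) rfl (by omega) ?_)
      refine .arith (W * β * base e ^ k) rfl (hW2.trans hbM) ?_
      dsimp only [Conf.put]
      refine .arith (A + W * β * base e ^ k) rfl hA ?_
      exact .arith 0 rfl (by omega) (.nil rfl)
    · next h => exact .iteFalse h (.nil (by rw [zero_mul, add_zero]))
  simp only [setupConf, paramConf]
  refine .arith (base e ^ (k + 1)) rfl hbM ?_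
  refine .arith (i * slots e.m e.n e.w + k + 1) rfl (by omega) ?_
  dsimp only [Conf.put]
  exact .arith 0 rfl (by omega) (.nil rfl)

/-- The two extra digits allowed in `M` leave room for the scratch products modulo `p`. -/
theorem base_pow_le (hM : base e ^ (slots e.m e.n e.w + 2) ≤ M) :
    2 * modulus e.m e.n * modulus e.m e.n ≤ M := by
  have hp : 2 ≤ modulus e.m e.n := (Fact.out : (modulus e.m e.n).Prime).two_le
  have hp2 : 2 ≤ base e := by unfold base; nlinarith
  calc 2 * modulus e.m e.n * modulus e.m e.n = 2 * base e := by rw [base, mul_assoc]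
    _ ≤ base e ^ 2 := by nlinarith
    _ ≤ M := (Nat.pow_le_pow_right (by omega) (by omega)).trans hM

/-- The configuration after `i` elements of the input stream. -/
noncomputable def inputConf (e : Env) (x : ℕ) (σ : Fin e.m → Fin e.n) (proof : List Bool)
    (i : ℕ) : Conf :=
  { setupConf e x ((List.ofFn fun i => (σ i : ℕ) + 1).drop i) proof with
    acc := accum e x σ i
    pos := i * slots e.m e.n e.w
    i := i }

theorem input_runs (hM : base e ^ (slots e.m e.n e.w + 2) ≤ M) (hw : 0 < e.w) (x : ℕ)
    (hx : x < 2 ^ wordLen e.m e.n) (σ : Fin e.m → Fin e.n) (proof : List Bool) :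
    Runs e M inputCode (setupConf e x (List.ofFn fun i => (σ i : ℕ) + 1) proof)
      { setupConf e x [] proof with
        acc := accum e x σ e.m
        pos := e.m * slots e.m e.n e.w } := by
  have hM2 := base_pow_le hM
  have hp : 2 ≤ modulus e.m e.n := (Fact.out : (modulus e.m e.n).Prime).two_le
  have hpM : 2 * modulus e.m e.n ≤ M := by nlinarith
  have hb2 : 2 ≤ base e := by unfold base; nlinarith
  have hmn := add_lt_modulus e.m e.n
  have hwd := width_le e.n e.w
  have hwpos := width_pos e.n hw
  have hnode := nodes_lt_modulus e.m e.n e.w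
  have hxp := two_pow_wordLen_le e.m e.n
  have hs := slots_le_modulus e.m e.n e.w
  refine .forLoop (inputConf e x σ proof) e.m (fun _ _ => rfl) (fun _ _ => rfl) (by omega) ?_ ?_
    fun i hi => ?_
  · have : accum e x σ 0 = 0 := by simp [accum, slot]
    simp only [inputConf, this, zero_mul]
    rfl
  · have : (List.ofFn fun i => (σ i : ℕ) + 1).drop e.m = [] := List.drop_eq_nil_of_le (by simp)
    simp only [inputConf, this]
    rfl
  have ha : elt σ i < e.n := by
    rw [elt, dif_pos hi]
    exact (σ _).2
  have hd := drop_ofFn_eq σ hi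
  have hacc := accum_succ x σ i
  have hlt := accum_lt x σ (Nat.succ_le_of_lt hi)
  have hbM : base e ^ slots e.m e.n e.w ≤ M :=
    (Nat.pow_le_pow_right (by omega) (by omega)).trans hM
  simp only [inputConf, hd, hacc]
  rw [Nat.succ_eq_add_one, hacc] at hlt
  generalize elt σ i = a at *
  generalize (List.ofFn fun i => (σ i : ℕ) + 1).drop (i + 1) = l
  generalize accum e x σ i = A at *
  have ha1 : a % width e.n e.w < width e.n e.w := Nat.mod_lt _ hwpos
  have ha2 : a / width e.n e.w ≤ a := Nat.div_le_self _ _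
  have hwp : width e.n e.w < modulus e.m e.n :=
    (Nat.le_mul_of_pos_left _ (by simp [factors, levels])).trans_lt
      ((Nat.lt_succ_self _).trans hnode)
  refine ⟨{ setupConf e x l proof with
    acc := A + ∑ k ∈ Finset.range (slots e.m e.n e.w), contrib e x a i k * base e ^ k
    pos := (i + 1) * slots e.m e.n e.w
    i := i }, ?_, rfl, rfl⟩
  simp only [setupConf, paramConf]
  refine .readInput rfl (by omega) ?_
  dsimp only [Conf.put]
  refine .arith a rfl (by omega) ?_
  refine .arith (a % width e.n e.w) rfl (by omega) ?_
  dsimp only [Conf.put]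
  refine .arith (a / width e.n e.w) rfl (by omega) ?_
  refine .arith 0 rfl (by omega) ?_
  dsimp only [Conf.put]
  refine .arith (width e.n e.w) rfl (by omega) ?_
  refine .cons (lagrange_runs (p := modulus e.m e.n) hM2 _ rfl (hx.le.trans hxp) (ha1.trans hwp)
    hwp.le rfl rfl rfl rfl) ?_
  dsimp only [Conf.put]
  refine .arith 1 rfl (by omega) ?_
  refine .cons (.forLoop (fun k => slotConf e x a i
    (A + ∑ k' ∈ Finset.range k, contrib e x a i k' * base e ^ k') l proof k)
    (slots e.m e.n e.w) (fun _ _ => rfl) (fun _ _ => rfl) (by omega) rfl rfl fun k hk => ?_) ?_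
  · refine ⟨_, slot_step_runs hM x a i _ l proof k hi hk ?_, rfl, ?_⟩
    -- A partly updated `acc` is at most its value after the whole element, which `accum_lt` bounds.
    · rw [add_assoc, ← Finset.sum_range_succ (fun k' => contrib e x a i k' * base e ^ k')]
      refine (Nat.add_le_add_left ?_ _).trans (hlt.le.trans hbM)
      exact Finset.sum_le_sum_of_subset (Finset.range_mono hk)
    · rw [add_assoc, ← Finset.sum_range_succ (fun k' => contrib e x a i k' * base e ^ k')]
      rfl
  simp only [slotConf, setupConf, paramConf, Conf.put]
  refine .arith 0 rfl (by omega) ?_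
  refine .arith 0 rfl (by omega) ?_
  refine .arith 0 rfl (by omega) ?_
  dsimp only [Conf.put]
  refine .arith 0 rfl (by omega) ?_
  refine .arith 0 rfl (by omega) ?_
  refine .arith 0 rfl (by omega) (.nil ?_)
  simp only [Conf.put, add_mul, one_mul]

end

/-! ### Evaluating the row products from the packed slots. -/

def factorCode : Cmd Reg :=
  block [
    assign .t .mod (.reg .acc) (.reg .bs),
    assign .acc .div (.reg .acc) (.reg .bs),
    assign .t .mod (.reg .t) (.reg .p),
    assign .tmp .add (.const 1) (.reg .p),
    assign .tmp .sub (.reg .tmp) (.reg .t),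
    assign .pr .mul (.reg .pr) (.reg .tmp),
    assign .pr .mod (.reg .pr) (.reg .p),
    assign .t .add (.const 0) (.const 0),
    assign .tmp .add (.const 0) (.const 0)]

/-- `V :=` the sum over all rows of `1 - ∏ (1 - c)`, `c` ranging over the slots of the row -/
def rowsCode : Cmd Reg :=
  forLoop .i (.reg .ht) (block [
    assign .pr .add (.const 1) (.const 0),
    forLoop .k (.reg .G) factorCode,
    assign .tmp .add (.const 1) (.reg .p),
    assign .tmp .sub (.reg .tmp) (.reg .pr),
    assign .V .add (.reg .V) (.reg .tmp),
    assign .V .mod (.reg .V) (.reg .p),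
    assign .pr .add (.const 0) (.const 0),
    assign .tmp .add (.const 0) (.const 0)])

/-- The number `∑ d (κ + j) * b ^ j`, which remains of `∑ d k * b ^ k` after `κ` divisions. -/
def tailSum (d : ℕ → ℕ) (b K κ : ℕ) : ℕ := ∑ j ∈ Finset.range (K - κ), d (κ + j) * b ^ j

theorem tailSum_eq (d : ℕ → ℕ) (b : ℕ) {K κ : ℕ} (h : κ < K) :
    tailSum d b K κ = d κ + b * tailSum d b K (κ + 1) := by
  rw [tailSum, tailSum, show K - κ = K - (κ + 1) + 1 by omega, Finset.sum_range_succ',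
    Finset.mul_sum, add_comm]
  congr 1
  · simp
  · refine Finset.sum_congr rfl fun j _ => ?_
    rw [show κ + (j + 1) = κ + 1 + j by omega]
    ring

section

variable {e : Env} {M : ℕ}

theorem factor_runs (hM : 2 * modulus e.m e.n * modulus e.m e.n ≤ M) (c : Conf) (d A : ℕ)
    (P : ZMod (modulus e.m e.n)) (hd : d < base e) (hA : c.acc = d + base e * A)
    (hAM : c.acc ≤ M) (hp : c.p = modulus e.m e.n) (hbs : c.bs = base e) (hP : c.pr = P.val)
    (ht : c.t = 0) (htmp : c.tmp = 0) :
    Runs e M factorCode c { c with acc := A, pr := (P * (1 - d)).val } := by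
  have hp2 : 2 ≤ modulus e.m e.n := (Fact.out : (modulus e.m e.n).Prime).two_le
  have hpM : 2 * modulus e.m e.n ≤ M := by nlinarith
  have hbM : base e ≤ M := by unfold base; nlinarith
  have h₁ : c.acc % c.bs = d := by
    rw [hA, hbs, Nat.add_mul_mod_self_left, Nat.mod_eq_of_lt hd]
  have h₂ : c.acc / c.bs = A := by
    rw [hA, hbs, Nat.add_mul_div_left _ _ (by omega), Nat.div_eq_of_lt hd, zero_add]
  have h₃ : d % c.p < modulus e.m e.n := hp ▸ Nat.mod_lt _ (by omega)
  have h₄ : P.val < modulus e.m e.n := ZMod.val_lt P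
  have h₅ : A ≤ M := h₂ ▸ (Nat.div_le_self _ _).trans hAM
  have h₆ : c.pr * (1 + c.p - d % c.p) ≤ M := by
    rw [hp] at h₃ ⊢
    rw [hP]
    exact (Nat.mul_le_mul h₄.le (by omega : _ ≤ 2 * modulus e.m e.n)).trans (by linarith)
  have h₇ : c.pr * (1 + c.p - d % c.p) % c.p = (P * (1 - d)).val := by
    rw [hp] at h₃ ⊢
    rw [hP, val_mul_sub_mod _ _ h₃.le, ZMod.natCast_mod, Nat.cast_one]
  refine .arith d h₁ (by omega) ?_
  dsimp only [Conf.put]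
  refine .arith A h₂ h₅ ?_
  dsimp only [Conf.put]
  refine .arith (d % c.p) rfl (by omega) ?_
  refine .arith (1 + c.p) rfl (by omega) ?_
  dsimp only [Conf.put]
  refine .arith (1 + c.p - d % c.p) rfl (by omega) ?_
  refine .arith (c.pr * (1 + c.p - d % c.p)) rfl h₆ ?_
  dsimp only [Conf.put]
  refine .arith (P * (1 - d)).val h₇ ((ZMod.val_lt _).le.trans (by omega)) ?_
  dsimp only [Conf.put]
  refine .arith 0 rfl (by omega) (.arith 0 rfl (by omega) (.nil ?_))
  ext1 <;> first | rfl | (symm; assumption)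

/-- The sum over the first `i` rows of `1 - ∏ (1 - c)`, `c` ranging over the slots of the row. -/
noncomputable def rowSum (e : Env) (d : ℕ → ℕ) (i : ℕ) : ZMod (modulus e.m e.n) :=
  ∑ y ∈ Finset.range i, (1 - ∏ g ∈ Finset.range (factors e.m e.n),
    (1 - (d (y * factors e.m e.n + g) : ZMod (modulus e.m e.n))))

/-- Slots are numbered row by row, so the digits of row `i` are the next `factors` ones to be
divided off `acc`, which ends at `0`. -/
theorem rows_runs (hM : 2 * modulus e.m e.n * modulus e.m e.n ≤ M) (c : Conf) (d : ℕ → ℕ)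
    (hd : ∀ k, d k < base e) (hbM : base e ^ slots e.m e.n e.w ≤ M)
    (hacc : c.acc = ∑ k ∈ Finset.range (slots e.m e.n e.w), d k * base e ^ k)
    (hp : c.p = modulus e.m e.n) (hbs : c.bs = base e) (hht : c.ht = height e.n e.w)
    (hG : c.G = factors e.m e.n)
    (hV : c.V = 0) (hi : c.i = 0) (hk : c.k = 0) (hpr : c.pr = 0) (ht : c.t = 0)
    (htmp : c.tmp = 0) :
    Runs e M rowsCode c { c with acc := 0, V := (rowSum e d (height e.n e.w)).val } := by
  have hp2 : 2 ≤ modulus e.m e.n := (Fact.out : (modulus e.m e.n).Prime).two_le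
  have hpM : 2 * modulus e.m e.n ≤ M := by nlinarith
  have hmn := add_lt_modulus e.m e.n
  have hh := height_le e.n e.w
  have hGp := factors_le_modulus e.m e.n
  have htail : ∀ κ, tailSum d (base e) (slots e.m e.n e.w) κ ≤ M := fun κ => by
    refine (sum_mul_pow_lt (b := base e) (d := fun j => d (κ + j)) fun _ _ => hd _).le.trans ?_
    exact (Nat.pow_le_pow_right ((Nat.zero_le _).trans_lt (hd 0)) (Nat.sub_le _ _)).trans hbM
  refine .forLoop (fun i => { c with
    acc := tailSum d (base e) (slots e.m e.n e.w) (i * factors e.m e.n)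
    V := (rowSum e d i).val
    i := i }) (height e.n e.w) (fun _ _ => rfl) (fun _ _ => hht) (by omega) ?_ ?_ fun i hi => ?_
  · ext1 <;> first | rfl | skip
    · simp [Conf.put, tailSum, hacc]
    · simp [Conf.put, rowSum, hV]
  · ext1 <;> first | rfl | (symm; assumption) | skip
    simp [Conf.put, tailSum, slots]
  have hsl : ∀ k < factors e.m e.n, i * factors e.m e.n + k < slots e.m e.n e.w := fun k hk => by
    have := Nat.mul_le_mul_right (factors e.m e.n) (Nat.succ_le_of_lt hi)
    rw [Nat.succ_mul] at this
    unfold slots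
    omega
  refine ⟨{ c with
    acc := tailSum d (base e) (slots e.m e.n e.w) ((i + 1) * factors e.m e.n)
    V := (rowSum e d (i + 1)).val
    i := i }, ?_, rfl, rfl⟩
  refine .arith 1 rfl (by omega) ?_
  dsimp only [Conf.put]
  refine .cons (.forLoop (fun k => { c with
    acc := tailSum d (base e) (slots e.m e.n e.w) (i * factors e.m e.n + k)
    V := (rowSum e d i).val
    i := i
    pr := (∏ g ∈ Finset.range k,
      (1 - (d (i * factors e.m e.n + g) : ZMod (modulus e.m e.n)))).val
    k := k }) (factors e.m e.n) (fun _ _ => rfl) (fun _ _ => hG)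
    (by omega) ?_ rfl fun k hk => ?_) ?_
  · ext1 <;> first | rfl | skip
    simp [Conf.put, ZMod.val_one'' (show modulus e.m e.n ≠ 1 by omega)]
  · refine ⟨_, factor_runs hM _ (d (i * factors e.m e.n + k))
      (tailSum d (base e) (slots e.m e.n e.w) (i * factors e.m e.n + (k + 1))) _ (hd _)
      (tailSum_eq d (base e) (hsl k hk)) (htail _) hp hbs rfl ht htmp, rfl, ?_⟩
    rw [← Finset.prod_range_succ
      (fun g => 1 - (d (i * factors e.m e.n + g) : ZMod (modulus e.m e.n)))]
    rfl
  rw [show (i + 1) * factors e.m e.n = i * factors e.m e.n + factors e.m e.n by ring]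
  have hrow : rowSum e d (i + 1) = rowSum e d i + (1 - ∏ g ∈ Finset.range (factors e.m e.n),
      (1 - (d (i * factors e.m e.n + g) : ZMod (modulus e.m e.n)))) :=
    Finset.sum_range_succ _ _
  rw [hrow]
  generalize (∏ g ∈ Finset.range (factors e.m e.n),
      (1 - (d (i * factors e.m e.n + g) : ZMod (modulus e.m e.n)))) = P
  generalize rowSum e d i = W
  have hP : P.val < modulus e.m e.n := ZMod.val_lt P
  have hW : W.val < modulus e.m e.n := ZMod.val_lt W
  have hstep : (W.val + (1 + c.p - P.val)) % c.p = (W + (1 - P)).val := by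
    rw [hp, val_add_mod, cast_add_sub hP.le]
    simp
  dsimp only [Conf.put]
  refine .arith (1 + c.p) rfl (by omega) ?_
  refine .arith (1 + c.p - P.val) rfl (by omega) ?_
  dsimp only [Conf.put]
  refine .arith (W.val + (1 + c.p - P.val)) rfl (by omega) ?_
  dsimp only [Conf.put]
  refine .arith (W + (1 - P)).val hstep ((ZMod.val_lt _).le.trans (by omega)) ?_
  dsimp only [Conf.put]
  refine .arith 0 rfl (by omega) (.arith 0 rfl (by omega) (.nil ?_))
  ext1 <;> first | rfl | assumption | (symm; assumption)

end

/-! ### Reading the proof stream, and the answer. -/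

/-- `val :=` the next word of the proof stream; missing bits count as `0` -/
def wordCode : Cmd Reg :=
  forLoop .k (.reg .B) (block [
    .instr (.readProof .t),
    -- `readProof` yields `0` at the end and `1` or `2` for a bit; halving maps the end to the bit
    -- `0`.
    assign .t .div (.reg .t) (.const 2),
    assign .val .mul (.reg .val) (.const 2),
    assign .val .add (.reg .val) (.reg .t),
    assign .t .add (.const 0) (.const 0)])

/-- Reads the values of a polynomial at `0, …, D - 1` from the proof stream. The register `ev`
receives its value at `xi`, and `tot` the sum of its values at `0, …, wd - 1`. -/
def proofCode : Cmd Reg :=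
  forLoop .i (.reg .D) (block [
    wordCode,
    assign .x .add (.reg .i) (.const 0),
    assign .nn .add (.reg .D) (.const 0),
    lagrangeCode,
    .ite (.lt (.reg .i) (.reg .wd))
      (block [
        assign .tot .add (.reg .tot) (.reg .val),
        assign .tot .mod (.reg .tot) (.reg .p)])
      (block []),
    assign .val .mul (.reg .val) (.reg .lag),
    assign .ev .add (.reg .ev) (.reg .val),
    assign .ev .mod (.reg .ev) (.reg .p),
    assign .val .add (.const 0) (.const 0),
    assign .x .add (.const 0) (.const 0),
    assign .nn .add (.const 0) (.const 0),
    assign .lag .add (.const 0) (.const 0)])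

/-- Accepts if the proof stream is exhausted and the two evaluations agree. -/
def answerCode : Cmd Reg :=
  block [
    .instr (.readProof .t),
    .ite (.eq (.reg .t) (.const 0))
      (block [.ite (.eq (.reg .ev) (.reg .V))
        (block [assign .out .add (.reg .tot) (.const 1)]) (block [])])
      (block [])]

def verifierCode : Cmd Reg :=
  -- The private coins use `B` bits, but `p` may exceed `2 ^ B`, so each word of the proof has `B +
  -- 1` bits.
  block [setupCode, inputCode, rowsCode, assign .B .add (.reg .B) (.const 1), proofCode, answerCode]

section

variable {e : Env} {M : ℕ}

/-- The `d`-th word of the proof `ω`. -/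
def word (e : Env) (ω : List Bool) (d : ℕ) : ℕ :=
  binVal (fun k => ω.getD (d * (wordLen e.m e.n + 1) + k) false) (wordLen e.m e.n + 1)

theorem word_lt (e : Env) (ω : List Bool) (d : ℕ) : word e ω d < 2 * modulus e.m e.n :=
  (binVal_lt _ _).trans_le ((pow_succ' _ _).trans_le
    (Nat.mul_le_mul_left 2 (two_pow_wordLen_le _ _)))

theorem proofSymbol_drop (ω : List Bool) (j : ℕ) :
    proofSymbol (ω.drop j) / 2 = (ω.getD j false).toNat := by
  rcases Nat.lt_or_ge j ω.length with h | h
  · rw [List.drop_eq_getElem_cons h, proofSymbol, List.getD_eq_getElem _ _ h]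
    cases ω[j] <;> rfl
  · rw [List.drop_eq_nil_of_le h, proofSymbol, List.getD_eq_default _ _ h]
    rfl

theorem proofSymbol_le (ω : List Bool) : proofSymbol ω ≤ 2 := by
  cases ω with
  | nil => exact Nat.zero_le _
  | cons b l => exact Nat.succ_le_succ (Bool.toNat_le b)

theorem word_runs (hM : 2 * modulus e.m e.n ≤ M) (c : Conf) (ω : List Bool) (d : ℕ)
    (hω : c.proof = ω.drop (d * (wordLen e.m e.n + 1))) (hB : c.B = wordLen e.m e.n + 1)
    (hval : c.val = 0) (ht : c.t = 0) (hk : c.k = 0) :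
    Runs e M wordCode c
      { c with val := word e ω d, proof := ω.drop ((d + 1) * (wordLen e.m e.n + 1)) } := by
  have hp2 : 2 ≤ modulus e.m e.n := (Fact.out : (modulus e.m e.n).Prime).two_le
  have h₂ := two_pow_wordLen_le e.m e.n
  have h₉ := wordLen_lt_modulus e.m e.n
  unfold word
  obtain ⟨f, hf⟩ : ∃ f, f = fun k => ω.getD (d * (wordLen e.m e.n + 1) + k) false := ⟨_, rfl⟩
  rw [← hf]
  refine .forLoop (fun k => { c with
    val := binVal f k, proof := ω.drop (d * (wordLen e.m e.n + 1) + k), k := k })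
    (wordLen e.m e.n + 1)
    (fun _ _ => rfl) (fun _ _ => hB) (by omega) ?_ ?_ fun k hk => ?_
  · ext1 <;> first | rfl | exact hω | exact hval
  · rw [Nat.succ_mul]
    ext1 <;> first | rfl | exact hk.symm
  · have hlt := binVal_lt f (k + 1)
    rw [binVal] at hlt
    have hle : 2 ^ (k + 1) ≤ 2 ^ (wordLen e.m e.n + 1) := pow_le_pow_right₀ one_le_two hk
    rw [pow_succ _ (wordLen e.m e.n)] at hle
    have hs := proofSymbol_le (ω.drop (d * (wordLen e.m e.n + 1) + k))
    have hs2 : proofSymbol (ω.drop (d * (wordLen e.m e.n + 1) + k)) / 2 = (f k).toNat := by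
      rw [proofSymbol_drop, hf]
    refine ⟨{ c with
      val := binVal f (k + 1), proof := ω.drop (d * (wordLen e.m e.n + 1) + (k + 1)), k := k },
      ?_, rfl, rfl⟩
    refine .readProof (hs.trans (by omega)) ?_
    dsimp only [Conf.put]
    refine .arith (f k).toNat hs2 (by omega) ?_
    refine .arith (binVal f k * 2) rfl (by omega) ?_
    dsimp only [Conf.put]
    refine .arith (binVal f (k + 1)) rfl (by rw [binVal]; omega) ?_
    refine .arith 0 rfl (by omega) (.nil ?_)
    ext1 <;> first | rfl | exact ht.symm | skip
    simp [Conf.put]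
    congr 1

/-- The value at `x` of the polynomial that the proof `ω` describes. -/
noncomputable def proofEval (e : Env) (ω : List Bool) (x i : ℕ) : ZMod (modulus e.m e.n) :=
  ∑ d ∈ Finset.range i, (word e ω d : ZMod (modulus e.m e.n)) *
    (lagr (modulus e.m e.n) (nodes e.m e.n e.w) d).eval (x : ZMod (modulus e.m e.n))

/-- The sum of the values at `0, …, wd - 1` of the polynomial that the proof `ω` describes. -/
noncomputable def proofTotal (e : Env) (ω : List Bool) (i : ℕ) : ZMod (modulus e.m e.n) :=
  ∑ d ∈ Finset.range i, if d < width e.n e.w then (word e ω d : ZMod (modulus e.m e.n)) else 0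

theorem proof_runs (hM : 2 * modulus e.m e.n * modulus e.m e.n ≤ M) (c : Conf) (ω : List Bool)
    (hω : c.proof = ω) (hp : c.p = modulus e.m e.n) (hxi : c.xi ≤ modulus e.m e.n)
    (hB : c.B = wordLen e.m e.n + 1) (hD : c.D = nodes e.m e.n e.w) (hwd : c.wd = width e.n e.w)
    (hval : c.val = 0) (ht : c.t = 0) (hk : c.k = 0) (hi : c.i = 0) (hx : c.x = 0) (hnn : c.nn = 0)
    (hlag : c.lag = 0) (htmp : c.tmp = 0) (hq : c.q = 0) (he : c.e = 0) (hev : c.ev = 0)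
    (htot : c.tot = 0) :
    Runs e M proofCode c { c with
      ev := (proofEval e ω c.xi (nodes e.m e.n e.w)).val
      tot := (proofTotal e ω (nodes e.m e.n e.w)).val
      proof := ω.drop (nodes e.m e.n e.w * (wordLen e.m e.n + 1)) } := by
  have hp2 : 2 ≤ modulus e.m e.n := (Fact.out : (modulus e.m e.n).Prime).two_le
  have hpM : 4 * modulus e.m e.n ≤ M := by nlinarith
  have hn := nodes_lt_modulus e.m e.n e.w
  refine .forLoop (fun i => { c with
    ev := (proofEval e ω c.xi i).val
    tot := (proofTotal e ω i).val
    proof := ω.drop (i * (wordLen e.m e.n + 1))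
    i := i }) (nodes e.m e.n e.w) (fun _ _ => rfl) (fun _ _ => hD) (by omega) ?_ ?_ fun i hin => ?_
  · ext1 <;> first | rfl | skip
    · simp [Conf.put, proofEval, hev]
    · simp [Conf.put, proofTotal, htot]
    · simp [Conf.put, hω]
  · ext1 <;> first | rfl | exact hi.symm
  have hev' : proofEval e ω c.xi (i + 1) = proofEval e ω c.xi i +
      word e ω i * (lagr (modulus e.m e.n) (nodes e.m e.n e.w) i).eval (c.xi : ZMod _) :=
    Finset.sum_range_succ _ _
  have htot' : proofTotal e ω (i + 1) = proofTotal e ω i +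
      if i < width e.n e.w then (word e ω i : ZMod (modulus e.m e.n)) else 0 :=
    Finset.sum_range_succ _ _
  refine ⟨{ c with
    ev := (proofEval e ω c.xi (i + 1)).val
    tot := (proofTotal e ω (i + 1)).val
    proof := ω.drop ((i + 1) * (wordLen e.m e.n + 1))
    i := i }, ?_, rfl, rfl⟩
  refine .cons (word_runs (by omega) _ ω i rfl hB hval ht hk) ?_
  rw [hev', htot']
  have hlt := word_lt e ω i
  generalize word e ω i = W at *
  generalize proofEval e ω c.xi i = E
  generalize proofTotal e ω i = T
  have hE : E.val < modulus e.m e.n := ZMod.val_lt E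
  have hT : T.val < modulus e.m e.n := ZMod.val_lt T
  dsimp only
  refine .arith i rfl (by omega) ?_
  refine .arith (nodes e.m e.n e.w) hD (by omega) ?_
  dsimp only [Conf.put]
  refine .cons (lagrange_runs hM _ hp hxi (hin.trans hn) hn.le ht he htmp hq) ?_
  dsimp only
  generalize (lagr (modulus e.m e.n) (nodes e.m e.n e.w) i).eval (c.xi : ZMod _) = Lg
  have hLg : Lg.val < modulus e.m e.n := ZMod.val_lt Lg
  have hWL : W * Lg.val + modulus e.m e.n ≤ 2 * modulus e.m e.n * modulus e.m e.n := by
    nlinarith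
  refine .cons (c' := { c with
    lag := Lg.val
    x := i
    nn := nodes e.m e.n e.w
    val := W
    ev := E.val
    tot := (T + if i < width e.n e.w then (W : ZMod (modulus e.m e.n)) else 0).val
    proof := ω.drop ((i + 1) * (wordLen e.m e.n + 1))
    i := i }) ?_ ?_
  · split
    · next h =>
      have hstep : (T.val + W) % c.p = (T + W).val := by rw [hp, val_add_mod]
      refine .iteTrue (h.trans_eq hwd.symm) (.arith (T.val + W) rfl (by omega) ?_)
      exact .arith (T + W).val hstep ((ZMod.val_lt _).le.trans (by omega)) (.nil rfl)
    · next h =>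
      refine .iteFalse (fun h' => h (h'.trans_eq hwd)) (.nil ?_)
      rw [add_zero]
  have hstep : (E.val + W * Lg.val) % c.p = (E + W * Lg).val := by
    rw [hp, val_add_mod]
    push_cast
    rw [ZMod.natCast_zmod_val]
  refine .arith (W * Lg.val) rfl (by linarith) ?_
  dsimp only [Conf.put]
  refine .arith (E.val + W * Lg.val) rfl (by linarith) ?_
  dsimp only [Conf.put]
  refine .arith (E + W * Lg).val hstep ((ZMod.val_lt _).le.trans (by omega)) ?_
  dsimp only [Conf.put]
  refine .arith 0 rfl (by omega) ?_
  refine .arith 0 rfl (by omega) ?_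
  dsimp only [Conf.put]
  refine .arith 0 rfl (by omega) ?_
  refine .arith 0 rfl (by omega) (.nil ?_)
  ext1 <;> first | rfl | (symm; assumption)

theorem answer_runs (c : Conf) (h2 : 2 ≤ M) (htot : c.tot + 1 ≤ M) (hout : c.out = 0) :
    ∃ c', Runs e M answerCode c c' ∧
      c'.out = if c.proof = [] ∧ c.ev = c.V then c.tot + 1 else 0 := by
  by_cases h : c.proof = []
  · have h0 : proofSymbol c.proof = 0 := by rw [h]; rfl
    by_cases h' : c.ev = c.V
    · rw [if_pos ⟨h, h'⟩]
      exact ⟨_, .readProof ((proofSymbol_le _).trans h2) (.cons (.iteTrue h0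
        (.cons (.iteTrue h' (.arith _ rfl htot (.nil rfl))) (.nil rfl))) (.nil rfl)), rfl⟩
    · rw [if_neg fun H => h' H.2]
      exact ⟨_, .readProof ((proofSymbol_le _).trans h2) (.cons (.iteTrue h0
        (.cons (.iteFalse h' (.nil rfl)) (.nil rfl))) (.nil rfl)), hout⟩
  · rw [if_neg fun H => h H.1]
    have h0 : proofSymbol c.proof ≠ 0 := by
      obtain ⟨b, l, hl⟩ := List.exists_cons_of_ne_nil h
      rw [hl]
      exact Nat.succ_ne_zero _
    exact ⟨_, .readProof ((proofSymbol_le _).trans h2) (.cons (.iteFalse h0 (.nil rfl))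
      (.nil rfl)), hout⟩

/-- The number made of the private coins `ρ`. -/
def coinVal {K : ℕ} (ρ : Fin K → Bool) : ℕ := binVal (fun i => (List.ofFn ρ).getD i false) K

theorem verifier_runs (hM : base e ^ (slots e.m e.n e.w + 2) ≤ M) (hw : 0 < e.w)
    (σ : Fin e.m → Fin e.n) (ω : List Bool) (ρ : Fin (wordLen e.m e.n) → Bool) :
    ∃ c', Runs e M verifierCode
      { input := List.ofFn fun i => (σ i : ℕ) + 1, proof := ω, coins := List.ofFn ρ } c' ∧
      c'.out = if ω.length ≤ nodes e.m e.n e.w * (wordLen e.m e.n + 1) ∧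
          proofEval e ω (coinVal ρ) (nodes e.m e.n e.w) =
            rowSum e (slot e (coinVal ρ) σ e.m) (height e.n e.w) then
        (proofTotal e ω (nodes e.m e.n e.w)).val + 1 else 0 := by
  have hM2 := base_pow_le hM
  have hp : 2 ≤ modulus e.m e.n := (Fact.out : (modulus e.m e.n).Prime).two_le
  have hpM : 2 * modulus e.m e.n ≤ M := by nlinarith
  have hb : 0 < base e := by unfold base; positivity
  have hx : coinVal ρ < 2 ^ wordLen e.m e.n := binVal_lt _ _
  have htot : (proofTotal e ω (nodes e.m e.n e.w)).val < modulus e.m e.n := ZMod.val_lt _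
  have hwl : wordLen e.m e.n + 1 ≤ modulus e.m e.n := wordLen_lt_modulus e.m e.n
  have h₁ := setup_runs hM2 (List.ofFn fun i => (σ i : ℕ) + 1) ω ρ
  have h₂ := input_runs hM hw _ hx σ ω
  have h₃ := rows_runs hM2 { setupConf e (coinVal ρ) [] ω with
    acc := accum e (coinVal ρ) σ e.m, pos := e.m * slots e.m e.n e.w } (slot e (coinVal ρ) σ e.m)
    (slot_lt _ σ le_rfl) ((Nat.pow_le_pow_right hb (by omega)).trans hM)
    rfl rfl rfl rfl rfl rfl rfl rfl rfl rfl rfl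
  have h₄ := proof_runs hM2 { setupConf e (coinVal ρ) [] ω with
    acc := 0, pos := e.m * slots e.m e.n e.w, B := wordLen e.m e.n + 1
    V := (rowSum e (slot e (coinVal ρ) σ e.m) (height e.n e.w)).val } ω
    rfl rfl (hx.le.trans (two_pow_wordLen_le _ _))
    rfl rfl rfl rfl rfl rfl rfl rfl rfl rfl rfl rfl rfl rfl rfl
  obtain ⟨c', h₅, hout⟩ := answer_runs (e := e) (M := M) { setupConf e (coinVal ρ) [] ω with
    acc := 0, pos := e.m * slots e.m e.n e.w, B := wordLen e.m e.n + 1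
    V := (rowSum e (slot e (coinVal ρ) σ e.m) (height e.n e.w)).val
    ev := (proofEval e ω (coinVal ρ) (nodes e.m e.n e.w)).val
    tot := (proofTotal e ω (nodes e.m e.n e.w)).val
    proof := ω.drop (nodes e.m e.n e.w * (wordLen e.m e.n + 1)) } (by omega)
    (show (proofTotal e ω (nodes e.m e.n e.w)).val + 1 ≤ M by omega) rfl
  refine ⟨c', .cons h₁ (.cons h₂ (.cons h₃ (.arith (wordLen e.m e.n + 1) rfl
    (hwl.trans (by omega)) (.cons h₄ (.cons h₅ (.nil rfl)))))), ?_⟩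
  rw [hout]
  simp only [List.drop_eq_nil_iff, (ZMod.val_injective _).eq_iff]

end

/-! ### The polynomials behind the computation, and their agreement at a random point. -/

section

variable {e : Env}

theorem natCast_injOn {p N : ℕ} (h : N ≤ p) :
    Set.InjOn (fun i : ℕ => (i : ZMod p)) (Finset.range N) := by
  intro a ha b hb hab
  rw [Finset.coe_range, Set.mem_Iio] at ha hb
  have : ((a : ℕ) : ZMod p) = (b : ℕ) := hab
  rw [← ZMod.val_natCast_of_lt (ha.trans_le h), this, ZMod.val_natCast_of_lt (hb.trans_le h)]

theorem eval_lagr {p N : ℕ} [Fact p.Prime] (h : N ≤ p) {a b : ℕ} (ha : a < N) (hb : b < N) :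
    (lagr p N a).eval (b : ZMod p) = if b = a then 1 else 0 := by
  split
  · next hab =>
    subst hab
    exact Lagrange.eval_basis_self (v := fun i : ℕ => (i : ZMod p)) (natCast_injOn h)
      (Finset.mem_range.2 hb)
  · next hab =>
    exact Lagrange.eval_basis_of_ne (v := fun i : ℕ => (i : ZMod p)) (Ne.symm hab)
      (Finset.mem_range.2 hb)

theorem natDegree_lagr_le {p N : ℕ} [Fact p.Prime] (h : N ≤ p) {a : ℕ} (ha : a < N) :
    (lagr p N a).natDegree ≤ N - 1 := by
  rw [natDegree_le_iff_degree_le, lagr,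
    Lagrange.degree_basis (natCast_injOn h) (Finset.mem_range.2 ha), Finset.card_range]

theorem eq_sum_lagr {p N : ℕ} [Fact p.Prime] (h : N ≤ p) {f : (ZMod p)[X]}
    (hf : f.degree < N) : f = ∑ d ∈ Finset.range N, C (f.eval (d : ZMod p)) * lagr p N d := by
  have := Lagrange.eq_interpolate (natCast_injOn h) (f := f) (by rwa [Finset.card_range])
  rw [Lagrange.interpolate_apply] at this
  exact this

/-- The content of slot `k` at the end, as a polynomial in the random point. -/
noncomputable def slotPoly (e : Env) (σ : Fin e.m → Fin e.n) (k : ℕ) :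
    (ZMod (modulus e.m e.n))[X] :=
  ∑ j ∈ Finset.range e.m, if k / factors e.m e.n = elt σ j / width e.n e.w then
    lagr (modulus e.m e.n) (width e.n e.w) (elt σ j % width e.n e.w) *
      C (chainBit e.r (levels e.m e.n) (j * slots e.m e.n e.w) k : ZMod (modulus e.m e.n))
  else 0

/-- The polynomial that the honest prover sends. -/
noncomputable def rowPoly (e : Env) (σ : Fin e.m → Fin e.n) : (ZMod (modulus e.m e.n))[X] :=
  ∑ y ∈ Finset.range (height e.n e.w), (1 - ∏ g ∈ Finset.range (factors e.m e.n),
    (1 - slotPoly e σ (y * factors e.m e.n + g)))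

/-- The polynomial that the proof `ω` describes. -/
noncomputable def proofPoly (e : Env) (ω : List Bool) : (ZMod (modulus e.m e.n))[X] :=
  ∑ d ∈ Finset.range (nodes e.m e.n e.w), C (word e ω d : ZMod (modulus e.m e.n)) *
    lagr (modulus e.m e.n) (nodes e.m e.n e.w) d

theorem eval_slotPoly (σ : Fin e.m → Fin e.n) (k x : ℕ) :
    (slotPoly e σ k).eval (x : ZMod (modulus e.m e.n)) = slot e x σ e.m k := by
  rw [slotPoly, slot, eval_finsetSum, Nat.cast_sum]
  refine Finset.sum_congr rfl fun j _ => ?_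
  unfold contrib weight
  split
  · rw [eval_mul, eval_C, Nat.cast_mul, ZMod.natCast_zmod_val]
  · rw [eval_zero, Nat.cast_zero]

theorem eval_rowPoly (σ : Fin e.m → Fin e.n) (x : ℕ) :
    (rowPoly e σ).eval (x : ZMod (modulus e.m e.n)) =
      rowSum e (slot e x σ e.m) (height e.n e.w) := by
  simp only [rowPoly, rowSum, eval_finsetSum, eval_sub, eval_one, eval_prod, eval_slotPoly]

theorem eval_proofPoly (ω : List Bool) (x : ℕ) :
    (proofPoly e ω).eval (x : ZMod (modulus e.m e.n)) =
      proofEval e ω x (nodes e.m e.n e.w) := by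
  simp only [proofPoly, proofEval, eval_finsetSum, eval_mul, eval_C]

theorem width_lt_nodes (m n w : ℕ) : width n w < nodes m n w :=
  Nat.lt_succ_of_le (Nat.le_mul_of_pos_left _ (by simp [factors, levels]))

theorem natDegree_slotPoly_le (hw : 0 < e.w) (σ : Fin e.m → Fin e.n) (k : ℕ) :
    (slotPoly e σ k).natDegree ≤ width e.n e.w := by
  refine natDegree_sum_le_of_forall_le _ _ fun j _ => ?_
  split
  · refine (natDegree_mul_C_le _ _).trans ((natDegree_lagr_le ?_ ?_).trans (Nat.sub_le _ _))
    · exact ((width_lt_nodes _ _ _).trans (nodes_lt_modulus _ _ _)).le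
    · exact Nat.mod_lt _ (width_pos _ hw)
  · simp

/-- The degree is governed by the number of slots of a row and does not grow with the number of
occurrences; this is the gain from subsampling. -/
theorem natDegree_rowPoly_lt (hw : 0 < e.w) (σ : Fin e.m → Fin e.n) :
    (rowPoly e σ).natDegree < nodes e.m e.n e.w := by
  refine Nat.lt_succ_of_le (natDegree_sum_le_of_forall_le _ _ fun y _ => ?_)
  refine (natDegree_sub_le _ _).trans (max_le (by simp) ((natDegree_prod_le _ _).trans ?_))
  refine (Finset.sum_le_card_nsmul _ _ (width e.n e.w) fun g _ => ?_).trans (by simp)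
  exact (natDegree_sub_le _ _).trans (max_le (by simp) (natDegree_slotPoly_le hw σ _))

theorem natDegree_proofPoly_lt (ω : List Bool) :
    (proofPoly e ω).natDegree < nodes e.m e.n e.w := by
  refine Nat.lt_succ_of_le (natDegree_sum_le_of_forall_le _ _ fun d hd => ?_)
  exact (natDegree_C_mul_le _ _).trans
    (natDegree_lagr_le (nodes_lt_modulus _ _ _).le (Finset.mem_range.1 hd))

theorem eval_proofPoly_natCast (ω : List Bool) {d : ℕ} (hd : d < nodes e.m e.n e.w) :
    (proofPoly e ω).eval (d : ZMod (modulus e.m e.n)) = word e ω d := by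
  rw [proofPoly, eval_finsetSum, Finset.sum_eq_single_of_mem d (Finset.mem_range.2 hd)]
  · rw [eval_mul, eval_C, eval_lagr (nodes_lt_modulus _ _ _).le hd hd, if_pos rfl, mul_one]
  · intro d' hd' hne
    rw [eval_mul, eval_lagr (nodes_lt_modulus _ _ _).le (Finset.mem_range.1 hd') hd,
      if_neg hne.symm, mul_zero]

theorem proofTotal_eq (ω : List Bool) :
    proofTotal e ω (nodes e.m e.n e.w) = ∑ d ∈ Finset.range (width e.n e.w),
      (proofPoly e ω).eval (d : ZMod (modulus e.m e.n)) := by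
  have hsub := (width_lt_nodes e.m e.n e.w).le
  rw [proofTotal, ← Finset.sum_filter]
  refine Finset.sum_congr ?_ fun d hd => ?_
  · ext d
    simp only [Finset.mem_filter, Finset.mem_range]
    omega
  · rw [eval_proofPoly_natCast ω ((Finset.mem_range.1 hd).trans_le hsub)]

/-- Every sequence of residues is described by some proof. -/
theorem exists_proof (e : Env) (f : ℕ → ZMod (modulus e.m e.n)) :
    ∃ ω : List Bool, ω.length ≤ nodes e.m e.n e.w * (wordLen e.m e.n + 1) ∧
      ∀ d < nodes e.m e.n e.w, (word e ω d : ZMod (modulus e.m e.n)) = f d := by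
  have hlt : ∀ d, (f d).val < 2 ^ (wordLen e.m e.n + 1) := fun d =>
    (ZMod.val_lt _).trans_le ((modulus_le _ _).trans_eq (pow_succ' _ _).symm)
  choose g hg using fun d => exists_binVal_eq (hlt d)
  refine ⟨List.ofFn fun i : Fin (nodes e.m e.n e.w * (wordLen e.m e.n + 1)) =>
    g (i / (wordLen e.m e.n + 1)) (i % (wordLen e.m e.n + 1)), by simp, fun d hd => ?_⟩
  have : word e (List.ofFn fun i : Fin (nodes e.m e.n e.w * (wordLen e.m e.n + 1)) =>
      g (i / (wordLen e.m e.n + 1)) (i % (wordLen e.m e.n + 1))) d = (f d).val := by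
    rw [← hg d, word]
    refine binVal_congr fun k hk => ?_
    have hlt : d * (wordLen e.m e.n + 1) + k < nodes e.m e.n e.w * (wordLen e.m e.n + 1) := by
      have := Nat.mul_le_mul_right (wordLen e.m e.n + 1) (Nat.succ_le_of_lt hd)
      rw [Nat.succ_mul] at this
      omega
    rw [List.getD_eq_getElem _ _ (by simpa using hlt), List.getElem_ofFn]
    simp only
    rw [Nat.mul_comm d, Nat.mul_add_div (Nat.succ_pos _), Nat.div_eq_of_lt hk, Nat.mul_add_mod,
      Nat.mod_eq_of_lt hk, add_zero]
  rw [this, ZMod.natCast_zmod_val]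

theorem exists_proofPoly_eq (hw : 0 < e.w) (σ : Fin e.m → Fin e.n) :
    ∃ ω : List Bool, ω.length ≤ nodes e.m e.n e.w * (wordLen e.m e.n + 1) ∧
      proofPoly e ω = rowPoly e σ := by
  obtain ⟨ω, hlen, hω⟩ := exists_proof e fun d => (rowPoly e σ).eval (d : ZMod (modulus e.m e.n))
  refine ⟨ω, hlen, ?_⟩
  have h := eq_sum_lagr (nodes_lt_modulus e.m e.n e.w).le
    (degree_le_natDegree.trans_lt (Nat.cast_lt.2 (natDegree_rowPoly_lt hw σ)))
  rw [proofPoly, h]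
  refine Finset.sum_congr rfl fun d hd => ?_
  rw [hω d (Finset.mem_range.1 hd)]

theorem coinVal_injective (K : ℕ) : Function.Injective (coinVal : (Fin K → Bool) → ℕ) := by
  intro ρ ρ' h
  funext i
  simpa using eq_of_binVal_eq h i i.2

/-- Distinct polynomials of low degree rarely agree at the random point. -/
theorem prob_agree_le {f g : (ZMod (modulus e.m e.n))[X]} (hfg : f ≠ g) {D : ℕ}
    (hf : f.natDegree ≤ D) (hg : g.natDegree ≤ D) :
    (prob fun ρ : Fin (wordLen e.m e.n) → Bool => f.eval (coinVal ρ : ZMod (modulus e.m e.n)) =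
      g.eval (coinVal ρ : ZMod (modulus e.m e.n))) ≤ D / 2 ^ wordLen e.m e.n := by
  classical
  unfold prob
  gcongr
  -- Coins at which `f` and `g` agree inject into the roots of `f - g`, since distinct coin strings
  -- give distinct numbers below `p`.
  refine le_trans (Finset.card_le_card_of_injOn
    (t := (f - g).roots.toFinset) (fun ρ => (coinVal ρ : ZMod (modulus e.m e.n))) ?_ ?_) ?_
  · intro ρ hρ
    have h : f.eval (coinVal ρ : ZMod (modulus e.m e.n)) =
        g.eval (coinVal ρ : ZMod (modulus e.m e.n)) := by simpa using hρ
    simp [Multiset.mem_toFinset, sub_ne_zero.2 hfg, IsRoot, h]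
  · intro ρ _ ρ' _ h
    have hlt : ∀ ρ : Fin (wordLen e.m e.n) → Bool, coinVal ρ < modulus e.m e.n := fun ρ =>
      (binVal_lt _ _).trans_le (two_pow_wordLen_le _ _)
    have h' : ((coinVal ρ : ℕ) : ZMod (modulus e.m e.n)) = (coinVal ρ' : ℕ) := h
    refine coinVal_injective _ ?_
    rw [← ZMod.val_natCast_of_lt (hlt ρ), h', ZMod.val_natCast_of_lt (hlt ρ')]
  · exact (Multiset.toFinset_card_le _).trans ((card_roots' _).trans
      ((natDegree_sub_le _ _).trans (max_le hf hg)))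

end

/-! ### Isolation makes the column sum equal to the number of distinct elements. -/

section

variable {e : Env}

/-- The number of occurrences of `a` in the stream that slot `k` selects. -/
def selected (e : Env) (σ : Fin e.m → Fin e.n) (a k : ℕ) : ℕ :=
  ∑ j ∈ Finset.range e.m, if elt σ j = a then
    chainBit e.r (levels e.m e.n) (j * slots e.m e.n e.w) k else 0

/-- The common random string isolates an occurrence of every element of the stream. -/
def Isolates (e : Env) (σ : Fin e.m → Fin e.n) : Prop :=
  ∀ i, ∃ g < factors e.m e.n,
    selected e σ (σ i) ((σ i : ℕ) / width e.n e.w * factors e.m e.n + g) = 1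

/-- At a column the Lagrange basis is an indicator, so only occurrences of the element in cell `(y,
d)` survive and the value is a plain count. -/
theorem eval_slotPoly_natCast (hw : 0 < e.w) (σ : Fin e.m → Fin e.n) {d y g : ℕ}
    (hd : d < width e.n e.w) (hg : g < factors e.m e.n) :
    (slotPoly e σ (y * factors e.m e.n + g)).eval (d : ZMod (modulus e.m e.n)) =
      selected e σ (y * width e.n e.w + d) (y * factors e.m e.n + g) := by
  have hwp : width e.n e.w ≤ modulus e.m e.n :=
    ((width_lt_nodes _ _ _).trans (nodes_lt_modulus _ _ _)).le
  have hw' := width_pos e.n hw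
  rw [slotPoly, selected, eval_finsetSum, Nat.cast_sum]
  refine Finset.sum_congr rfl fun j _ => ?_
  have hdiv : (y * factors e.m e.n + g) / factors e.m e.n = y := by
    rw [Nat.mul_comm, Nat.mul_add_div (by omega), Nat.div_eq_of_lt hg, add_zero]
  have hiff : elt σ j = y * width e.n e.w + d ↔
      y = elt σ j / width e.n e.w ∧ d = elt σ j % width e.n e.w := by
    constructor
    · intro h
      rw [h, Nat.mul_comm, Nat.mul_add_div hw', Nat.div_eq_of_lt hd, Nat.mul_add_mod,
        Nat.mod_eq_of_lt hd]
      exact ⟨rfl, rfl⟩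
    · rintro ⟨rfl, rfl⟩
      rw [Nat.mul_comm, Nat.div_add_mod]
  rw [hdiv]
  simp only [hiff]
  by_cases h : y = elt σ j / width e.n e.w
  · rw [if_pos h, eval_mul, eval_C, eval_lagr hwp (Nat.mod_lt _ hw') hd]
    simp only [h, true_and]
    split <;> simp
  · rw [if_neg h, if_neg fun H => h H.1]
    simp

theorem sum_range_mul_eq {R : Type*} [AddCommMonoid R] (f : ℕ → R) (a b : ℕ) :
    ∑ k ∈ Finset.range (a * b), f k =
      ∑ y ∈ Finset.range a, ∑ d ∈ Finset.range b, f (y * b + d) := by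
  induction a with
  | zero => simp
  | succ a ih => rw [Nat.succ_mul, Finset.sum_range_add, ih, Finset.sum_range_succ]

theorem elt_of_fin {m n : ℕ} (σ : Fin m → Fin n) (i : Fin m) : elt σ i = σ i := by
  simp [elt]

theorem lt_height_mul_width (hw : 0 < e.w) {a : ℕ} (ha : a < e.n) :
    a < height e.n e.w * width e.n e.w := by
  have hw' := width_pos e.n hw
  have h := Nat.div_le_div_right (c := width e.n e.w) ha.le
  exact (Nat.div_lt_iff_lt_mul hw').1 (Nat.lt_succ_of_le h)

/-- For a present element one count equal to `1` kills the product, whatever the other counts are;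
for an absent one all counts are `0`. Each cell thus contributes its indicator. -/
theorem sum_eval_rowPoly (hw : 0 < e.w) (σ : Fin e.m → Fin e.n) (h : Isolates e σ) :
    ∑ d ∈ Finset.range (width e.n e.w), (rowPoly e σ).eval (d : ZMod (modulus e.m e.n)) =
      ((Finset.univ.image σ).card : ZMod (modulus e.m e.n)) := by
  classical
  have hw' := width_pos e.n hw
  let T : Finset ℕ := Finset.univ.image fun i => (σ i : ℕ)
  have hT : T.card = (Finset.univ.image σ).card := by
    rw [show T = (Finset.univ.image σ).image Fin.val by rw [Finset.image_image]; rfl]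
    exact Finset.card_image_of_injective _ Fin.val_injective
  have hsub : T ⊆ Finset.range (height e.n e.w * width e.n e.w) := fun a ha => by
    obtain ⟨i, -, rfl⟩ := Finset.mem_image.1 ha
    exact Finset.mem_range.2 (lt_height_mul_width hw (σ i).2)
  have key : ∀ d < width e.n e.w, ∀ y,
      (1 - ∏ g ∈ Finset.range (factors e.m e.n), (1 - slotPoly e σ (y * factors e.m e.n + g))).eval
        (d : ZMod (modulus e.m e.n)) = if y * width e.n e.w + d ∈ T then 1 else 0 := by
    intro d hd y
    rw [eval_sub, eval_one, eval_prod]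
    split
    · next hmem =>
      obtain ⟨i, -, hi⟩ := Finset.mem_image.1 hmem
      obtain ⟨g, hg, hsel⟩ := h i
      have hy : (σ i : ℕ) / width e.n e.w = y := by
        rw [hi, Nat.mul_comm, Nat.mul_add_div hw', Nat.div_eq_of_lt hd, add_zero]
      rw [hy, hi] at hsel
      rw [Finset.prod_eq_zero (Finset.mem_range.2 hg), sub_zero]
      rw [eval_sub, eval_one, eval_slotPoly_natCast hw σ hd hg, hsel, Nat.cast_one, sub_self]
    · next hmem =>
      rw [Finset.prod_eq_one, sub_self]
      intro g hg
      rw [eval_sub, eval_one, eval_slotPoly_natCast hw σ hd (Finset.mem_range.1 hg), selected,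
        Finset.sum_eq_zero, Nat.cast_zero, sub_zero]
      intro j hj
      refine if_neg fun hj' => hmem (Finset.mem_image.2 ⟨⟨j, Finset.mem_range.1 hj⟩,
        Finset.mem_univ _, ?_⟩)
      rw [← hj', ← elt_of_fin]
  simp only [rowPoly, eval_finsetSum]
  -- The double sum over rows and columns is a single sum over the cells `y * width + d`, among
  -- which `T` lies.
  rw [Finset.sum_comm, Finset.sum_congr rfl fun y _ => Finset.sum_congr rfl fun d hd =>
    key d (Finset.mem_range.1 hd) y,
    ← sum_range_mul_eq fun a => if a ∈ T then (1 : ZMod (modulus e.m e.n)) else 0,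
    ← Finset.sum_filter, Finset.sum_const, nsmul_one, Finset.filter_mem_eq_inter,
    Finset.inter_eq_right.2 hsub, hT]

/-- The residue determines the count, because at most `n` elements are distinct and `n < p`. -/
theorem proofTotal_val (hw : 0 < e.w) (σ : Fin e.m → Fin e.n) (h : Isolates e σ) {ω : List Bool}
    (hω : proofPoly e ω = rowPoly e σ) :
    (proofTotal e ω (nodes e.m e.n e.w)).val = (Finset.univ.image σ).card := by
  have hcard : (Finset.univ.image σ).card < modulus e.m e.n :=
    ((Finset.card_le_univ _).trans_eq (Fintype.card_fin _)).trans_lt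
      ((Nat.le_add_left _ _).trans_lt (add_lt_modulus _ _))
  rw [proofTotal_eq, hω, sum_eval_rowPoly hw σ h, ZMod.val_natCast_of_lt hcard]

end

/-! ### The isolation estimate and independence, as counting statements. -/

section

open Classical in
theorem card_forall_mem_eq_true {β : Type*} [Fintype β] [DecidableEq β] (S : Finset β) :
    ((Finset.univ.filter fun f : β → Bool => ∀ b ∈ S, f b = true).card : ℝ) * 2 ^ S.card =
      2 ^ Fintype.card β := by
  have h : (Finset.univ.filter fun f : β → Bool => ∀ b ∈ S, f b = true) =
      Fintype.piFinset fun b => if b ∈ S then {true} else Finset.univ := by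
    ext f
    simp only [Finset.mem_filter, Finset.mem_univ, true_and, Fintype.mem_piFinset]
    refine forall_congr' fun b => ?_
    split <;> simp_all
  rw [h, Fintype.card_piFinset]
  have h₁ : ∀ b, (if b ∈ S then ({true} : Finset Bool) else Finset.univ).card =
      if b ∈ S then 1 else 2 := fun b => by split <;> rfl
  have h₂ : (2 : ℕ) ^ S.card = ∏ b, if b ∈ S then 2 else 1 := by
    rw [Finset.prod_ite, Finset.prod_const_one, mul_one, Finset.prod_const,
      Finset.filter_mem_eq_inter, Finset.univ_inter]
  simp only [h₁]
  rw [← Nat.cast_two (R := ℝ), ← Nat.cast_pow, h₂, ← Nat.cast_mul, ← Finset.prod_mul_distrib,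
    ← Nat.cast_pow]
  congr 1
  rw [← Finset.card_univ, ← Finset.prod_const]
  refine Finset.prod_congr rfl fun b _ => ?_
  split <;> rfl

open Classical in
/-- The number of `j ∈ J` whose first `u + 1` bits are all `1`. -/
noncomputable def chosen {α : Type*} {U : ℕ} (J : Finset α) (u : ℕ) (f : α × Fin U → Bool) : ℕ :=
  (J.filter fun j => ∀ v : Fin U, (v : ℕ) ≤ u → f (j, v) = true).card

open Classical in
/-- Isolation: if `2 ^ u` is close to the size of `J`, exactly one element is often chosen. -/
theorem card_chosen_ne_one {α : Type*} [Fintype α] [DecidableEq α] {U u : ℕ}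
    (J : Finset α) (hu : u < U)
    (h₁ : J.card ≤ 2 ^ u) (h₂ : 2 ^ u ≤ 2 * J.card) :
    ((Finset.univ.filter fun f : α × Fin U → Bool => chosen J u f ≠ 1).card : ℝ) ≤
      7 / 8 * 2 ^ Fintype.card (α × Fin U) := by
  let S : α → Finset (α × Fin U) := fun j =>
    (Finset.univ.filter fun v : Fin U => (v : ℕ) ≤ u).image fun v => (j, v)
  have hS : ∀ j, (S j).card = u + 1 := fun j => by
    rw [Finset.card_image_of_injective _ (Prod.mk_right_injective j)]
    rw [show (Finset.univ.filter fun v : Fin U => (v : ℕ) ≤ u) = Finset.Iic ⟨u, hu⟩ by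
      ext v; simp [Fin.le_def]]
    simp
  let sel : α → (α × Fin U → Bool) → Prop := fun j f => ∀ v : Fin U, (v : ℕ) ≤ u → f (j, v) = true
  have hsel : ∀ j f, sel j f ↔ ∀ b ∈ S j, f b = true := fun j f => by
    simp [S, sel]
  set A : ℝ := 2 ^ Fintype.card (α × Fin U) with hA
  set Q : ℝ := 2 ^ (u + 1) with hQ
  have hQ0 : 0 < Q := by positivity
  have c₁ : ∀ j, (∑ f, if sel j f then (1 : ℝ) else 0) = A / Q := fun j => by
    rw [Finset.sum_boole, eq_div_iff hQ0.ne', hA, ← card_forall_mem_eq_true (S j), hS j, hQ]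
    simp only [hsel]
  -- Distinct elements are chosen by disjoint sets of bits, hence independently.
  have c₂ : ∀ j j', j ≠ j' →
      (∑ f, (if sel j f then (1 : ℝ) else 0) * if sel j' f then 1 else 0) = A / Q ^ 2 := by
    intro j j' hne
    have hd : Disjoint (S j) (S j') := by
      rw [Finset.disjoint_left]
      intro b hb hb'
      simp only [S, Finset.mem_image] at hb hb'
      obtain ⟨v, -, rfl⟩ := hb
      obtain ⟨v', -, h⟩ := hb'
      exact hne (Prod.mk.inj h).1.symm
    have hb := card_forall_mem_eq_true (S j ∪ S j')
    rw [Finset.card_union_of_disjoint hd, hS, hS, pow_add, ← hQ, ← hA] at hb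
    rw [eq_div_iff (by positivity), ← hb, sq]
    congr 1
    rw [← Finset.sum_boole]
    refine Finset.sum_congr rfl fun f _ => ?_
    simp only [hsel, Finset.mem_union, or_imp, forall_and]
    split <;> split <;> simp_all
  have hch : ∀ f : α × Fin U → Bool, (chosen J u f : ℝ) =
      ∑ j ∈ J, if sel j f then (1 : ℝ) else 0 := fun f => by
    rw [Finset.sum_boole]
    rfl
  have e₁ : ∑ f : α × Fin U → Bool, (chosen J u f : ℝ) = J.card * (A / Q) := by
    simp only [hch]
    rw [Finset.sum_comm]
    simp only [c₁]
    rw [Finset.sum_const, nsmul_eq_mul]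
  have e₂ : ∑ f : α × Fin U → Bool, (chosen J u f : ℝ) ^ 2 =
      J.card * (A / Q) + J.card * ((J.card - 1) * (A / Q ^ 2)) := by
    simp only [hch, sq, Finset.sum_mul_sum]
    rw [Finset.sum_comm (s := Finset.univ), ← mul_add, ← nsmul_eq_mul, ← Finset.sum_const]
    refine Finset.sum_congr rfl fun j hj => ?_
    rw [Finset.sum_comm, ← Finset.add_sum_erase J _ hj]
    congr 1
    · rw [← c₁ j]
      refine Finset.sum_congr rfl fun f _ => ?_
      split <;> simp
    · rw [Finset.sum_congr rfl fun j' hj' => c₂ j j' (Finset.ne_of_mem_erase hj').symm,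
        Finset.sum_const, Finset.card_erase_of_mem hj, nsmul_eq_mul,
        Nat.cast_sub (Finset.card_pos.2 ⟨j, hj⟩), Nat.cast_one]
      simp only [sq]
  -- The right side is `(k - 1) ^ 2`, so two moments of `chosen` suffice.
  have hpt : ∀ k : ℕ, (if k ≠ 1 then (1 : ℝ) else 0) ≤ 1 - 2 * k + k ^ 2 := fun k => by
    rcases k with _ | _ | k
    · simp
    · norm_num
    · rw [if_pos (by omega)]
      push_cast
      nlinarith [(Nat.cast_nonneg k : (0 : ℝ) ≤ k)]
  have htot : ((Finset.univ.filter fun f : α × Fin U → Bool => chosen J u f ≠ 1).card : ℝ) ≤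
      A - 2 * (J.card * (A / Q)) + (J.card * (A / Q) + J.card * ((J.card - 1) * (A / Q ^ 2))) := by
    rw [← Finset.sum_boole, ← e₂, ← e₁, Finset.mul_sum]
    have hA' : A = ∑ _f : α × Fin U → Bool, (1 : ℝ) := by simp [hA]
    rw [hA', ← Finset.sum_sub_distrib, ← Finset.sum_add_distrib]
    exact Finset.sum_le_sum fun f _ => hpt _
  refine htot.trans ?_
  have t₁ : (J.card : ℝ) ≤ Q / 2 := by
    rw [hQ, pow_succ, mul_div_cancel_right₀ _ two_ne_zero]
    exact_mod_cast h₁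
  have t₂ : Q / 4 ≤ (J.card : ℝ) := by
    have : (2 : ℝ) ^ u ≤ 2 * J.card := by exact_mod_cast h₂
    rw [hQ, pow_succ]
    linarith
  have hA0 : 0 < A := by positivity
  -- `x` is the expected number of chosen elements, between `1/4` and `1/2`; the bound becomes `1 -
  -- x + x ^ 2 - x / Q`.
  obtain ⟨x, hx⟩ : ∃ x : ℝ, x = J.card / Q := ⟨_, rfl⟩
  have hx₁ : x ≤ 1 / 2 := by rw [hx, div_le_iff₀ hQ0]; linarith
  have hx₂ : 1 / 4 ≤ x := by rw [hx, le_div_iff₀ hQ0]; linarith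
  have hJ : (J.card : ℝ) = x * Q := by rw [hx, div_mul_cancel₀ _ hQ0.ne']
  rw [hJ]
  have : A - 2 * (x * Q * (A / Q)) + (x * Q * (A / Q) + x * Q * ((x * Q - 1) * (A / Q ^ 2))) =
      A * (1 - x + x ^ 2 - x / Q) := by
    field_simp
    ring
  rw [this]
  have hxQ : 0 ≤ x / Q := by positivity
  -- `(1/2 - x) * (x - 1/4) ≥ 0` gives `1 - x + x ^ 2 ≤ 7/8 - x/4`.
  nlinarith [mul_nonneg (sub_nonneg.2 hx₁) (sub_nonneg.2 hx₂)]

open Classical in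
/-- Independence of the coordinates of a uniformly random family. -/
theorem card_forall_mem {ι Ω : Type*} [Fintype ι] [DecidableEq ι] [Fintype Ω] (B : Finset ι)
    (E : Finset Ω)
    {q : ℝ} (hE : (E.card : ℝ) ≤ q * Fintype.card Ω) :
    ((Finset.univ.filter fun F : ι → Ω => ∀ i ∈ B, F i ∈ E).card : ℝ) ≤
      q ^ B.card * Fintype.card (ι → Ω) := by
  have h : (Finset.univ.filter fun F : ι → Ω => ∀ i ∈ B, F i ∈ E) =
      Fintype.piFinset fun i => if i ∈ B then E else Finset.univ := by
    ext f
    simp only [Finset.mem_filter, Finset.mem_univ, true_and, Fintype.mem_piFinset]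
    refine forall_congr' fun b => ?_
    split <;> simp_all
  rw [h, Fintype.card_piFinset, Fintype.card_fun, Nat.cast_prod, Nat.cast_pow,
    ← Finset.card_univ (α := ι), ← Finset.prod_const (Fintype.card Ω : ℝ)]
  have h₂ : q ^ B.card = ∏ i : ι, if i ∈ B then q else 1 := by
    rw [Finset.prod_ite, Finset.prod_const_one, mul_one, Finset.prod_const,
      Finset.filter_mem_eq_inter, Finset.univ_inter]
  rw [h₂, ← Finset.prod_mul_distrib]
  refine Finset.prod_le_prod (fun _ _ => Nat.cast_nonneg _) fun i _ => ?_
  split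
  · exact hE
  · rw [one_mul, Finset.card_univ]

end

/-! ### The common random string as independent trials, and the union bound. -/

section

/-- The number of independent trials. -/
def trials (m n : ℕ) : ℕ := (logSize m n + 3) * 6

/-- The common random bits, numbered by trial (over all rows), position in the stream, level. -/
def bitEquiv (m T U : ℕ) : Fin T × (Fin m × Fin U) ≃ Fin (m * (T * U)) :=
  (Equiv.mk (fun x => (x.2.1, (x.1, x.2.2))) (fun x => (x.2.1, (x.1, x.2.2)))
    (fun _ => rfl) (fun _ => rfl) :
    Fin T × (Fin m × Fin U) ≃ Fin m × (Fin T × Fin U)).trans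
    (((Equiv.refl _).prodCongr finProdFinEquiv).trans finProdFinEquiv)

/-- The family of trials that a common random string contains. -/
def trialEquiv (m T U : ℕ) : (Fin (m * (T * U)) → Bool) ≃ (Fin T → Fin m × Fin U → Bool) :=
  ((bitEquiv m T U).symm.arrowCongr (Equiv.refl _)).trans (Equiv.curry _ _ _)

/-- The numbering agrees with the order in which the verifier queries: stream position, then trial,
then level. -/
theorem trialEquiv_apply {m T U : ℕ} (r : Fin (m * (T * U)) → Bool) (τ : Fin T) (j : Fin m)
    (v : Fin U) :
    trialEquiv m T U r τ (j, v) = oracleOf r (j * (T * U) + (τ * U + v)) := by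
  have h : ((bitEquiv m T U (τ, (j, v)) : Fin _) : ℕ) = j * (T * U) + (τ * U + v) := by
    simp only [bitEquiv, Equiv.trans_apply, Equiv.coe_fn_mk, Equiv.prodCongr_apply, Prod.map,
      Equiv.refl_apply, finProdFinEquiv_apply_val]
    ring
  rw [oracleOf, dif_pos (h ▸ (bitEquiv m T U (τ, (j, v))).2)]
  simp only [← h]
  rfl

theorem slots_eq (m n w : ℕ) : slots m n w = height n w * trials m n * levels m n :=
  (mul_assoc _ _ _).symm

open Classical in
theorem selected_eq_chosen {m n s w : ℕ}
    (r : Fin (m * (height n w * trials m n * levels m n)) → Bool) (σ : Fin m → Fin n) (a : ℕ)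
    (τ : Fin (height n w * trials m n)) {u : ℕ} (hu : u < levels m n) :
    selected ⟨m, n, s, w, oracleOf r⟩ σ a (τ * levels m n + u) =
      chosen (Finset.univ.filter fun j => (σ j : ℕ) = a) u
        (trialEquiv m (height n w * trials m n) (levels m n) r τ) := by
  rw [chosen, Finset.card_filter, Finset.sum_filter, selected, Finset.sum_range]
  refine Finset.sum_congr rfl fun j _ => ?_
  rw [elt_of_fin]
  refine if_congr Iff.rfl ?_ rfl
  have hmod : (τ * levels m n + u) % levels m n = u := by
    rw [Nat.mul_comm, Nat.mul_add_mod, Nat.mod_eq_of_lt hu]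
  simp only [chainBit, hmod, slots_eq]
  -- `chainBit` counts levels backwards from `u` and `chosen` counts forwards, so the two are
  -- matched by `v = u - u'`.
  refine if_congr ⟨fun h v hv => ?_, fun h u' hu' => ?_⟩ rfl rfl
  · rw [trialEquiv_apply, ← h (u - v) (Nat.sub_le _ _)]
    congr 1
    omega
  · have := h ⟨u - u', by omega⟩ (Nat.sub_le _ _)
    rw [trialEquiv_apply] at this
    rw [← this]
    congr 1
    simp only
    omega

open Classical in
/-- A fixed element of the stream is rarely missed by all trials of its row. -/
theorem card_not_isolated {m n s w : ℕ} (σ : Fin m → Fin n) (i : Fin m) :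
    ((Finset.univ.filter fun r : Fin (m * (height n w * trials m n * levels m n)) → Bool =>
      ∀ g < factors m n, selected ⟨m, n, s, w, oracleOf r⟩ σ (σ i)
        ((σ i : ℕ) / width n w * factors m n + g) ≠ 1).card : ℝ) ≤
      (7 / 8) ^ trials m n * 2 ^ (m * (height n w * trials m n * levels m n)) := by
  let J : Finset (Fin m) := Finset.univ.filter fun j => (σ j : ℕ) = σ i
  have hJ0 : J.card ≠ 0 := Finset.card_ne_zero_of_mem (a := i) (by simp [J])
  have hJm : J.card ≤ m := (Finset.card_le_univ _).trans_eq (Fintype.card_fin m)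
  -- The level adapted to the number of occurrences of `σ i`: `J.card ≤ 2 ^ u ≤ 2 * J.card`. The
  -- verifier need not know it, since every level is a slot.
  obtain ⟨u, hu⟩ : ∃ u, u = Nat.clog 2 J.card := ⟨_, rfl⟩
  have hu₁ : J.card ≤ 2 ^ u := hu ▸ Nat.le_pow_clog one_lt_two _
  have hu₂ : 2 ^ u ≤ 2 * J.card := by
    rcases Nat.lt_or_ge 1 J.card with h | h
    · have h' := Nat.pow_pred_clog_lt_self one_lt_two h
      have hpos := Nat.clog_pos one_lt_two h
      rw [hu, ← Nat.succ_pred_eq_of_pos hpos, pow_succ]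
      omega
    · have h1 : J.card = 1 := by omega
      rw [hu, h1]
      simp
  have huU : u < levels m n := by
    refine Nat.lt_succ_of_le (hu ▸ Nat.clog_le_of_le_pow ?_)
    have := lt_two_pow_logSize m n
    omega
  have hy : (σ i : ℕ) / width n w < height n w :=
    Nat.lt_succ_of_le (Nat.div_le_div_right (σ i).2.le)
  -- The trials of the row of `σ i`. Missing every slot of the row means missing level `u` in each
  -- of them.
  let B : Finset (Fin (height n w * trials m n)) := Finset.univ.image fun l : Fin (trials m n) =>
    finProdFinEquiv (⟨(σ i : ℕ) / width n w, hy⟩, l)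
  have hB : B.card = trials m n := by
    rw [Finset.card_image_of_injective _ fun l l' h => by simpa using h]
    simp
  have hE := card_chosen_ne_one (U := levels m n) J huU hu₁ hu₂
  have hcard : (2 : ℝ) ^ Fintype.card (Fin m × Fin (levels m n)) =
      (Fintype.card (Fin m × Fin (levels m n) → Bool) : ℝ) := by simp
  rw [hcard] at hE
  have hB' := card_forall_mem B _ hE
  rw [hB, ← Fintype.card_congr (trialEquiv m (height n w * trials m n) (levels m n))] at hB'
  refine le_trans (Nat.cast_le.2 (Finset.card_le_card_of_injOn
    (trialEquiv m (height n w * trials m n) (levels m n)) ?_ (Equiv.injective _).injOn))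
    (hB'.trans_eq (by simp))
  intro r hr
  simp only [Finset.coe_filter, Finset.mem_univ, true_and, Set.mem_ofPred_eq] at hr ⊢
  intro τ hτ
  obtain ⟨l, -, rfl⟩ := Finset.mem_image.1 hτ
  simp only [Finset.mem_filter, Finset.mem_univ, true_and]
  rw [← selected_eq_chosen r σ (σ i) _ huU (s := s)]
  have hg : (l : ℕ) * levels m n + u < factors m n := by
    have := Nat.mul_le_mul_right (levels m n) (Nat.succ_le_of_lt l.2)
    rw [Nat.succ_mul] at this
    exact (Nat.add_lt_add_left huU _).trans_le this
  have := hr _ hg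
  rwa [show (σ i : ℕ) / width n w * factors m n + (l * levels m n + u) =
    (l + trials m n * ((σ i : ℕ) / width n w)) * levels m n + u by
      rw [factors, ← trials]; ring] at this

theorem prob_eq_one_sub {k : ℕ} (P : (Fin k → Bool) → Prop) :
    prob P = 1 - prob fun r => ¬ P r := by
  classical
  have h := Finset.card_filter_add_card_filter_not (s := (Finset.univ : Finset (Fin k → Bool))) P
  have h' : ((Finset.univ.filter P).card : ℝ) + (Finset.univ.filter fun r => ¬ P r).card =
      2 ^ k := by
    rw [← Nat.cast_add, h]
    simp
  unfold prob
  rw [eq_sub_iff_add_eq, ← add_div, div_eq_one_iff_eq (by positivity), ← h']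
  congr!

theorem prob_mono {k : ℕ} {P Q : (Fin k → Bool) → Prop} (h : ∀ r, P r → Q r) :
    prob P ≤ prob Q := by
  unfold prob
  gcongr
  exact h _

theorem prob_isolates {m n s w : ℕ} (σ : Fin m → Fin n) :
    5 / 6 ≤ prob fun r : Fin (m * (height n w * trials m n * levels m n)) → Bool =>
      Isolates ⟨m, n, s, w, oracleOf r⟩ σ := by
  classical
  -- Six trials fail together with probability at most `(7/8) ^ 6 ≤ 1/2`. Of `logSize + 3` such
  -- groups, `logSize` pay for the union over `m` positions and three leave `1/8 ≤ 1/6`.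
  have hsmall : (m : ℝ) * (7 / 8) ^ trials m n ≤ 1 / 8 := by
    have h₁ : ((7 : ℝ) / 8) ^ trials m n ≤ (1 / 2) ^ (logSize m n + 3) := by
      rw [trials, mul_comm, pow_mul]
      exact pow_le_pow_left₀ (by norm_num) (by norm_num) _
    have h₂ : (m : ℝ) ≤ 2 ^ logSize m n := by
      exact_mod_cast (Nat.le_add_right m n).trans (lt_two_pow_logSize m n).le
    calc (m : ℝ) * (7 / 8) ^ trials m n ≤ 2 ^ logSize m n * (1 / 2) ^ (logSize m n + 3) := by
          gcongr
      _ = 1 / 8 := by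
          rw [pow_add, ← mul_assoc, ← mul_pow]
          norm_num
  rw [prob_eq_one_sub]
  suffices h : (prob fun r : Fin (m * (height n w * trials m n * levels m n)) → Bool =>
      ¬ Isolates ⟨m, n, s, w, oracleOf r⟩ σ) ≤ 1 / 8 by linarith
  unfold prob
  rw [div_le_iff₀ (by positivity)]
  let bad : Fin m → Finset (Fin (m * (height n w * trials m n * levels m n)) → Bool) := fun i =>
    Finset.univ.filter fun r => ∀ g < factors m n, selected ⟨m, n, s, w, oracleOf r⟩ σ (σ i)
        ((σ i : ℕ) / width n w * factors m n + g) ≠ 1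
  have hsub : (Finset.univ.filter fun r : Fin (m * (height n w * trials m n * levels m n)) →
      Bool => ¬ Isolates ⟨m, n, s, w, oracleOf r⟩ σ) ⊆ Finset.univ.biUnion bad := by
    intro r hr
    rw [Finset.mem_filter] at hr
    obtain ⟨i, hi⟩ := not_forall.1 hr.2
    refine Finset.mem_biUnion.2 ⟨i, Finset.mem_univ _, Finset.mem_filter.2 ⟨Finset.mem_univ _, ?_⟩⟩
    exact fun g hg h => hi ⟨g, hg, h⟩
  have hle := (Finset.card_le_card hsub).trans Finset.card_biUnion_le
  have hle' : ((Finset.univ.filter fun r : Fin (m * (height n w * trials m n * levels m n)) →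
      Bool => ¬ Isolates ⟨m, n, s, w, oracleOf r⟩ σ).card : ℝ) ≤ ∑ i, ((bad i).card : ℝ) := by
    exact_mod_cast hle
  refine le_trans ?_ ((hle'.trans (Finset.sum_le_sum fun i _ => card_not_isolated σ i)).trans ?_)
  · exact le_of_eq (by congr!)
  · rw [Finset.sum_const, Finset.card_univ, Fintype.card_fin, nsmul_eq_mul, ← mul_assoc]
    gcongr

end

/-! ### Space, proof length, and the final assembly. -/

section

theorem Exec.mono {V : Type} [Fintype V] [DecidableEq V] {e : Env} {S T : ℕ} (hST : S ≤ T)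
    {c : Cmd V} {st st' : State V} (h : Exec e S c st st') : Exec e T c st st' := by
  induction h with
  | skip st => exact .skip st
  | instr i st st' h hS => exact .instr i st st' h (hS.trans hST)
  | seq c₁ c₂ st st' st'' _ _ ih₁ ih₂ => exact .seq _ _ _ _ _ ih₁ ih₂
  | iteTrue t c₁ c₂ st st' ht _ ih => exact .iteTrue _ _ _ _ _ ht ih
  | iteFalse t c₁ c₂ st st' ht _ ih => exact .iteFalse _ _ _ _ _ ht ih
  | loopDone t c st ht => exact .loopDone _ _ _ ht
  | loopStep t c st st' st'' ht _ _ ih₁ ih₂ => exact .loopStep _ _ _ _ _ ht ih₁ ih₂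

theorem card_reg : Fintype.card Reg = 31 := rfl

/-- With `L` for `logSize`: at most `98 * s * L ^ 2` digits (`98 = 2 * 48 + 2`) of `22 * L` bits in
each of `31` registers, and `31 * 22 * 98 + 31 ≤ 67000`. -/
theorem size_register_le {e : Env} (hs : 0 < e.s) (h : e.n ≤ e.s * e.w) :
    Fintype.card Reg * (base e ^ (slots e.m e.n e.w + 2)).size ≤
      e.s * (67000 * logSize e.m e.n ^ 3) := by
  have hl := logSize_pos e.m e.n
  have hbase : base e ≤ 2 ^ (22 * logSize e.m e.n) := by
    have hp : modulus e.m e.n ≤ 2 ^ (11 * logSize e.m e.n) :=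
      (modulus_le _ _).trans ((pow_succ' _ _).symm.le.trans
        (Nat.pow_le_pow_right two_pos (by rw [wordLen]; omega)))
    exact (Nat.mul_le_mul hp hp).trans_eq (by rw [← pow_add]; congr 1; ring)
  have hslots : slots e.m e.n e.w + 2 ≤ 98 * (e.s * logSize e.m e.n ^ 2) := by
    have h₁ := Nat.mul_le_mul (height_le_two_mul hs h) (factors_le e.m e.n)
    have h₂ : 1 ≤ e.s * logSize e.m e.n ^ 2 := Nat.mul_pos hs (pow_pos hl 2)
    unfold slots
    linarith
  have hsize : (base e ^ (slots e.m e.n e.w + 2)).size ≤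
      22 * logSize e.m e.n * (98 * (e.s * logSize e.m e.n ^ 2)) + 1 := by
    rw [Nat.size_le]
    refine lt_of_le_of_lt ?_ (Nat.pow_lt_pow_right one_lt_two (Nat.lt_succ_self _))
    rw [pow_mul]
    exact (Nat.pow_le_pow_left hbase _).trans (Nat.pow_le_pow_right (by positivity) hslots)
  have h₃ : 1 ≤ e.s * logSize e.m e.n ^ 3 := Nat.mul_pos hs (pow_pos hl 3)
  rw [card_reg]
  calc 31 * (base e ^ (slots e.m e.n e.w + 2)).size
      ≤ 31 * (22 * logSize e.m e.n * (98 * (e.s * logSize e.m e.n ^ 2)) + 1) :=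
        Nat.mul_le_mul_left _ hsize
    _ = 66836 * (e.s * logSize e.m e.n ^ 3) + 31 := by ring
    _ ≤ e.s * (67000 * logSize e.m e.n ^ 3) := by linarith

theorem proof_length_le {m n w : ℕ} (hw : 0 < w) :
    nodes m n w * (wordLen m n + 1) ≤ w * (67000 * logSize m n ^ 3) := by
  have hl := logSize_pos m n
  have h₁ := Nat.mul_le_mul (factors_le m n) (width_le_self n (w := w))
  have h₂ : 1 ≤ logSize m n ^ 2 * w := Nat.mul_pos (pow_pos hl 2) hw
  have h₃ : nodes m n w ≤ 49 * (logSize m n ^ 2 * w) := by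
    unfold nodes
    linarith
  have h₄ : wordLen m n + 1 ≤ 11 * logSize m n := by
    unfold wordLen
    omega
  calc nodes m n w * (wordLen m n + 1)
      ≤ 49 * (logSize m n ^ 2 * w) * (11 * logSize m n) := Nat.mul_le_mul h₃ h₄
    _ = 539 * (w * logSize m n ^ 3) := by ring
    _ ≤ w * (67000 * logSize m n ^ 3) := by
      have := Nat.zero_le (w * logSize m n ^ 3)
      linarith

/-- The verifier for the number of distinct elements. -/
def distinctVerifier : Verifier where
  V := Reg
  code := verifierCode
  out := .out

open Classical in
theorem distinctVerifier_outputs {m n s w R : ℕ} (hs : 0 < s) (hw : 0 < w) (h : n ≤ s * w)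
    (σ : Fin m → Fin n) (r : Fin R → Bool) (ω : List Bool) (ρ : Fin (wordLen m n) → Bool) :
    distinctVerifier.Outputs s w (s * (67000 * logSize m n ^ 3)) σ r ω ρ
      (if ω.length ≤ nodes m n w * (wordLen m n + 1) ∧
          (proofPoly ⟨m, n, s, w, oracleOf r⟩ ω).eval (coinVal ρ : ZMod (modulus m n)) =
            (rowPoly ⟨m, n, s, w, oracleOf r⟩ σ).eval (coinVal ρ : ZMod (modulus m n)) then
        some (proofTotal ⟨m, n, s, w, oracleOf r⟩ ω (nodes m n w)).val else none) := by
  obtain ⟨c', hrun, hout⟩ := verifier_runs (e := ⟨m, n, s, w, oracleOf r⟩)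
    (M := base ⟨m, n, s, w, oracleOf r⟩ ^ (slots m n w + 2)) le_rfl hw σ ω ρ
  have hexec := (hrun fun v => by cases v <;> exact Nat.zero_le _).1
  refine ⟨c'.toState, ?_, ?_⟩
  · have h₀ : (⟨fun _ => 0, List.ofFn fun i => (σ i : ℕ) + 1, ω, List.ofFn ρ⟩ : State Reg) =
        ({ input := List.ofFn fun i => (σ i : ℕ) + 1, proof := ω, coins := List.ofFn ρ } :
          Conf).toState := by
      unfold Conf.toState
      congr 1
      funext v
      cases v <;> rfl
    have := hexec.mono (size_register_le (e := ⟨m, n, s, w, oracleOf r⟩) hs h)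
    rw [← h₀] at this
    exact this
  · rw [show c'.toState.regs distinctVerifier.out = c'.out from rfl, hout]
    have h₁ := eval_proofPoly (e := ⟨m, n, s, w, oracleOf r⟩) ω (coinVal ρ)
    have h₂ := eval_rowPoly (e := ⟨m, n, s, w, oracleOf r⟩) σ (coinVal ρ)
    rw [← h₁, ← h₂]
    split <;> rfl

theorem prob_eq_one {k : ℕ} {P : (Fin k → Bool) → Prop} (h : ∀ r, P r) : prob P = 1 := by
  simp [prob, h]

theorem distinctVerifier_isAM {m n s w : ℕ} (hs : 0 < s) (hw : 0 < w) (h : n ≤ s * w) :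
    distinctVerifier.IsAM distinctElements 0 (1 / 3) m n s w
      (s * (67000 * logSize m n ^ 3)) (w * (67000 * logSize m n ^ 3)) := by
  classical
  refine ⟨m * (height n w * trials m n * levels m n), wordLen m n,
    fun σ r ω ρ => ⟨_, distinctVerifier_outputs hs hw h σ r ω ρ⟩, fun σ => ?_⟩
  refine le_trans (by norm_num) ((prob_isolates (s := s) (w := w) σ).trans
    (prob_mono fun r hr => ?_))
  -- A polynomial can have several encodings (unreduced words, omitted final zeros). All of them
  -- must belong to the set, since soundness requires rejection outside it.
  refine ⟨{ω | ω.length ≤ nodes m n w * (wordLen m n + 1) ∧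
    proofPoly ⟨m, n, s, w, oracleOf r⟩ ω = rowPoly ⟨m, n, s, w, oracleOf r⟩ σ},
    exists_proofPoly_eq (e := ⟨m, n, s, w, oracleOf r⟩) hw σ,
    fun ω hω => hω.1.trans (proof_length_le hw), fun ω hω => ?_, fun ω hω => ?_⟩
  · rw [prob_eq_one]
    · norm_num
    · intro ρ
      have hout := distinctVerifier_outputs hs hw h σ r ω ρ
      rw [if_pos ⟨hω.1, by rw [hω.2]⟩, proofTotal_val (e := ⟨m, n, s, w, oracleOf r⟩) hw σ hr hω.2]
        at hout
      exact ⟨_, hout, by simp [distinctElements]⟩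
  -- An overlong proof is always rejected; otherwise the proof describes a different polynomial, and
  -- the random point decides.
  · rcases Nat.lt_or_ge (nodes m n w * (wordLen m n + 1)) ω.length with hlen | hlen
    · rw [prob_eq_one]
      · norm_num
      · intro ρ
        have hout := distinctVerifier_outputs hs hw h σ r ω ρ
        rwa [if_neg fun H => H.1.not_gt hlen] at hout
    · have hne : proofPoly ⟨m, n, s, w, oracleOf r⟩ ω ≠ rowPoly ⟨m, n, s, w, oracleOf r⟩ σ :=
        fun H => hω ⟨hlen, H⟩
      refine lt_of_lt_of_le ?_ (prob_mono (P := fun ρ : Fin (wordLen m n) → Bool =>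
        ¬ (proofPoly ⟨m, n, s, w, oracleOf r⟩ ω).eval (coinVal ρ : ZMod (modulus m n)) =
            (rowPoly ⟨m, n, s, w, oracleOf r⟩ σ).eval (coinVal ρ : ZMod (modulus m n)))
        fun ρ hρ => ?_)
      · have hprob := prob_agree_le (e := ⟨m, n, s, w, oracleOf r⟩) hne
          (Nat.le_sub_one_of_lt (natDegree_proofPoly_lt (e := ⟨m, n, s, w, oracleOf r⟩) ω))
          (Nat.le_sub_one_of_lt (natDegree_rowPoly_lt (e := ⟨m, n, s, w, oracleOf r⟩) hw σ))
        have hsix : (6 : ℝ) * (nodes m n w - 1 : ℕ) < 2 ^ wordLen m n := by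
          exact_mod_cast six_mul_nodes_lt m n w
        replace hprob := lt_of_le_of_lt hprob
          (show ((nodes m n w - 1 : ℕ) : ℝ) / 2 ^ wordLen m n < 1 / 6 by
            rw [div_lt_iff₀ (by positivity)]
            linarith)
        rw [prob_eq_one_sub] at hprob
        linarith
      · have hout := distinctVerifier_outputs hs hw h σ r ω ρ
        rwa [if_neg fun H => hρ H.2] at hout

end

end AMStreaming

theorem mainTheorem3 :
    ∃ (A : AMStreaming.Verifier) (C c : ℕ), ∀ m n s w : ℕ, 0 < s → 0 < w → n ≤ s * w →
      A.IsAM AMStreaming.distinctElements 0 (1 / 3) m n s w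
        (s * (C * (Nat.log 2 (m + n) + 1) ^ c))
        (w * (C * (Nat.log 2 (m + n) + 1) ^ c)) :=
  ⟨AMStreaming.distinctVerifier, 67000, 3, fun _ _ _ _ hs hw h =>
    AMStreaming.distinctVerifier_isAM hs hw h⟩
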